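/- **Theorem 4.1 (Main A).** Let $(A_0,{}^*)$ be the involution semigroup of order four on $\{1,2,3,4\}$ with multiplication table $$\begin{array}{c|cccc}\cdot&1&2&3&4\\\hline 1&2&2&1&2\\2&2&2&2&2\\3&2&2&3&2\\4&1&2&1&4\end{array}$$ and involution $1^*=1,\ 2^*=2,\ 3^*=4,\ 4^*=3$. An identity $s\approx t$ is a formal pair of terms built from the variables of a countably infinite alphabet by an (associative) product and the unary operation ${}^*$. An identity is deducible from a set $\Sigma$ of identities if its left side can be transformed into its right side in finitely many steps, each replacing a subterm $p\varphi$ by $q\varphi$, where $\varphi$ is a substitution of terms for variables and $p\approx q$ or $q\approx p$ belongs to $\Sigma$; the associative law may always be used. A set $\Sigma$ of identities satisfied by $(A_0,{}^*)$ is an identity basis for $(A_0,{}^*)$ if every identity satisfied by $(A_0,{}^*)$ is deducible from $\Sigma$. The following finite set of identities is an identity basis for $(A_0,{}^*)$: $$(x^*)^*\approx x,\qquad (xy)^*\approx y^*x^*,$$ $$xx^*x\approx 0,\qquad xyx^*\approx xy^*x^*,\qquad xTx^*y\approx y^*xTx^*,$$ $$x^2Tx^*\approx xTx^*\approx xT(x^*)^2,\qquad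 x^2\approx x^3,\qquad xyx\approx yxy\approx xyxy.$$ Here $x,y,T$ are variables, $w\approx 0$ abbreviates the two identities $wy\approx w\approx yw$ with $y$ a variable not occurring in $w$, and each identity containing $T$ stands for two identities: itself, and the one obtained from it by deleting $T$. -/

import Mathlib

/-- Terms in the signature of involution semigroups (one binary operation, one unary operation `*`)
over the countably infinite alphabet `ℕ`. -/
inductive InvTerm : Type
  | var : ℕ → InvTerm
  | mul : InvTerm → InvTerm → InvTerm
  | inv : InvTerm → InvTerm

namespace InvTerm

instance : Mul InvTerm := ⟨InvTerm.mul⟩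

instance : Star InvTerm := ⟨InvTerm.inv⟩

/-- The value of a term in an algebra `S` with a multiplication and a unary operation `star`,
under the assignment `φ` of elements of `S` to the variables. -/
def eval {S : Type*} [Mul S] [Star S] (φ : ℕ → S) : InvTerm → S
  | var n => φ n
  | mul s t => eval φ s * eval φ t
  | inv s => star (eval φ s)

/-- The term `tφ` obtained from `t` by the substitution `φ` of terms for variables. -/
def subst (φ : ℕ → InvTerm) : InvTerm → InvTerm
  | var n => φ n
  | mul s t => subst φ s * subst φ t
  | inv s => star (subst φ s)

/-- `Replace p q s t`: the term `t` results from the term `s` by replacing one particular occurrence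
of the subterm `p` with `q`. -/
inductive Replace (p q : InvTerm) : InvTerm → InvTerm → Prop
  | here : Replace p q p q
  | mul_left {s t : InvTerm} (r : InvTerm) : Replace p q s t → Replace p q (s * r) (t * r)
  | mul_right {s t : InvTerm} (r : InvTerm) : Replace p q s t → Replace p q (r * s) (r * t)
  | inv {s t : InvTerm} : Replace p q s t → Replace p q (star s) (star t)

end InvTerm

/-- An identity `lhs ≈ rhs` is a formal pair of terms. -/
structure InvIdentity : Type where
  lhs : InvTerm
  rhs : InvTerm

infix:50 " ≈ᵢ " => InvIdentity.mk

namespace InvIdentity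

/-- The identity `e` holds in the involution semigroup `S`. -/
def SatisfiedBy (e : InvIdentity) (S : Type*) [Semigroup S] [StarMul S] : Prop :=
  ∀ φ : ℕ → S, e.lhs.eval φ = e.rhs.eval φ

/-- `s ≈ t` is directly deducible from `e`: for some substitution `φ`, the term `t` results from `s`
by replacing an occurrence of the subterm `e.lhs φ` with `e.rhs φ`. -/
def DirectlyDeduces (e : InvIdentity) (s t : InvTerm) : Prop :=
  ∃ φ : ℕ → InvTerm, InvTerm.Replace (e.lhs.subst φ) (e.rhs.subst φ) s t

/-- The associative law. -/
def assoc : InvIdentity :=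
  (InvTerm.var 0 * InvTerm.var 1) * InvTerm.var 2 ≈ᵢ
    InvTerm.var 0 * (InvTerm.var 1 * InvTerm.var 2)

/-- The identity `e` is deducible from the set `Γ` of identities: there is a finite sequence of terms
from `e.lhs` to `e.rhs` in which consecutive terms differ by one application, in either direction, of
an identity in `Γ`. Products are written without brackets, so that applying the associative law is
always allowed as well. -/
def DeducibleFrom (e : InvIdentity) (Γ : Set InvIdentity) : Prop :=
  Relation.EqvGen (fun s t => ∃ d ∈ insert assoc Γ, DirectlyDeduces d s t) e.lhs e.rhs

/-- The set `Γ` of identities is an identity basis for the involution semigroup `S`: its members are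
identities of `S`, and every identity of `S` is deducible from `Γ`. -/
def IsBasisFor (Γ : Set InvIdentity) (S : Type*) [Semigroup S] [StarMul S] : Prop :=
  (∀ e ∈ Γ, e.SatisfiedBy S) ∧ ∀ e : InvIdentity, e.SatisfiedBy S → e.DeducibleFrom Γ

end InvIdentity

/-- The underlying set `{1, 2, 3, 4}` of the semigroup `A₀`. -/
inductive A0 : Type
  | e1 | e2 | e3 | e4

namespace A0

/-- The multiplication table of `A₀`; the rows are
`1: 2 2 1 2`, `2: 2 2 2 2`, `3: 2 2 3 2`, `4: 1 2 1 4`. -/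
def mul : A0 → A0 → A0
  | e1, e3 => e1
  | e3, e3 => e3
  | e4, e1 => e1
  | e4, e3 => e1
  | e4, e4 => e4
  | _, _ => e2

/-- The involution of `A₀` fixes `1` and `2` and interchanges `3` and `4`. -/
def inv : A0 → A0
  | e1 => e1
  | e2 => e2
  | e3 => e4
  | e4 => e3

instance : Semigroup A0 where
  mul := mul
  mul_assoc a b c := by cases a <;> cases b <;> cases c <;> rfl

instance : StarMul A0 where
  star := inv
  star_involutive a := by cases a <;> rfl
  star_mul a b := by cases a <;> cases b <;> rfl

end A0

namespace A0Basis

/-- The variable `x`. -/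
def x : InvTerm := InvTerm.var 0

/-- The variable `y`. -/
def y : InvTerm := InvTerm.var 1

/-- The variable `T`. -/
def T : InvTerm := InvTerm.var 2

/-- The involution axioms `(x*)* ≈ x` and `(xy)* ≈ y* x*`. -/
def involution : Set InvIdentity :=
  {star (star x) ≈ᵢ x, star (x * y) ≈ᵢ star y * star x}

/-- `x x* x ≈ 0`, which abbreviates `x x* x y ≈ x x* x ≈ y x x* x`. -/
def zero : Set InvIdentity :=
  {x * star x * x * y ≈ᵢ x * star x * x, x * star x * x ≈ᵢ y * (x * star x * x)}

/-- `x y x* ≈ x y* x*`. -/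
def middle : Set InvIdentity :=
  {x * y * star x ≈ᵢ x * star y * star x}

/-- `x T x* y ≈ y* x T x*`, together with the identity that results from it by deleting `T`. -/
def transfer : Set InvIdentity :=
  {x * T * star x * y ≈ᵢ star y * x * T * star x,
   x * star x * y ≈ᵢ star y * x * star x}

/-- `x² T x* ≈ x T x* ≈ x T (x*)²`, together with the identities that result from deleting `T`. -/
def square : Set InvIdentity :=
  {x * x * T * star x ≈ᵢ x * T * star x,
   x * T * star x ≈ᵢ x * T * (star x * star x),
   x * x * star x ≈ᵢ x * star x,
   x * star x ≈ᵢ x * (star x * star x)}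

/-- `x² ≈ x³` and `x y x ≈ y x y ≈ x y x y`. -/
def plain : Set InvIdentity :=
  {x * x ≈ᵢ x * x * x, x * y * x ≈ᵢ y * x * y, y * x * y ≈ᵢ x * y * x * y}

end A0Basis

open A0Basis in
/-- The involution axioms together with the identities specific to `A₀`. -/
def a0Basis : Set InvIdentity :=
  involution ∪ zero ∪ middle ∪ transfer ∪ square ∪ plain

/-!
Every identity of `A₀` has to be derived from the basis. Terms modulo deducibility form an involution
semigroup `FreeModel` which satisfies the basis, so it is enough to show that two words (products of
variables and starred variables) with the same values in `A₀` have the same value in every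
involution semigroup that satisfies the basis. A common identity element is adjoined, so that the
versions of an identity with and without `T` become one (`Laws`).

*Normal forms.* The square of a product absorbs each of its letters (`sqVal_mul_letter`), so it
depends only on the set of its letters. If `E` absorbs two letters `x` and `p`, then
`E t x* = E t p*` (`Laws.exchange`), and `y (E T E*) = F T F*`, where `F` is the square for the letters
of `E` together with `y` (`letter_mul_normalVal`). With these rules, every word is either a zero or
equal to `E T E*` (`exists_form`), where `E` is the square of a possibly empty list `Q` of letters and
`T` is a product of blocks, each a single letter or a square, such that `Q` and the blocks involve
pairwise disjoint sets of variables. This goes by appending letters: a letter that recurs merges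
blocks of `T` or leads to zero, and a letter whose involute occurred before moves blocks of `T`
into `Q`.

*Uniqueness.* A product of elements `3` and `4` in `A₀` is nonzero only if all factors `4` precede all
factors `3`. So `E T E*` is nonzero under such an assignment precisely if all letters of `Q` have the
value `4` and `T` is cut between two blocks, with values `4` before and `3` after the cut. The nonzero
assignments therefore reveal the letters of `Q` and the sequence of blocks of `T` up to reversing `T`
by the involution (`form_unique`); the value `1` tells single letters from squares. For nonempty `Q`
the reversal is harmless because `E T E* = E T* E*`, and for empty `Q` the values of `T` and `T*` differ
when all letters of `T` are `3`.
-/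

namespace A0Words

/-- The identities of the basis, for a monoid without nontrivial factorizations of `1`. They are
required of elements other than `1`; the variable `T`, and every `y` for which this is harmless, may
also be `1`, so that each identity covers its version with `T` deleted. The intended model is a
semigroup with an identity element adjoined. -/
structure Laws (M : Type*) [Monoid M] [StarMul M] : Prop where
  eq_one_of_mul_left : ∀ a b : M, a * b = 1 → a = 1
  zero_mul : ∀ x y : M, x ≠ 1 → x * star x * x * y = x * star x * x
  mul_zero : ∀ x y : M, x ≠ 1 → y * (x * star x * x) = x * star x * x
  middle : ∀ x y : M, x ≠ 1 → x * y * star x = x * star y * star x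
  transfer : ∀ x t y : M, x ≠ 1 → x * t * star x * y = star y * (x * t * star x)
  square_left : ∀ x t : M, x ≠ 1 → x * x * t * star x = x * t * star x
  square_right : ∀ x t : M, x ≠ 1 → x * t * (star x * star x) = x * t * star x
  cube : ∀ x : M, x ≠ 1 → x * x * x = x * x
  braid : ∀ x y : M, x ≠ 1 → y ≠ 1 → x * y * x = y * x * y
  braid_absorb : ∀ x y : M, x ≠ 1 → y ≠ 1 → x * y * x * y = x * y * x

/-! ### Consequences of the identities -/

section Algebra

variable {M : Type*} [Monoid M] [StarMul M] (hM : Laws M)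
include hM

lemma Laws.mul_ne_one {a b : M} (ha : a ≠ 1) : a * b ≠ 1 :=
  fun h => ha (hM.eq_one_of_mul_left a b h)

omit hM in
lemma star_ne_one {a : M} (ha : a ≠ 1) : star a ≠ 1 := fun h => ha (by
  rw [← star_star a, h, star_one])

lemma Laws.sandwich_mul_inner {b : M} (hb : b ≠ 1) (y : M) : b * y * b * y = b * y * b := by
  by_cases hy : y = 1
  · simp [hy]
  · exact hM.braid_absorb b y hb hy

lemma Laws.sandwich_mul_outer {b : M} (hb : b ≠ 1) (y : M) : b * y * b * b = b * y * b := by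
  by_cases hy : y = 1
  · simpa [hy] using hM.cube b hb
  · rw [hM.braid b y hb hy, hM.braid_absorb y b hy hb]

/-- If `E` absorbs `x` and `p` on the right, then a closing factor `x*` may be exchanged for `p*`. -/
lemma Laws.exchange {E x p : M} (hx : x ≠ 1) (hp : p ≠ 1) (hEx : E * x = E) (hEp : E * p = E)
    (t : M) : E * t * star x * star p = E * t * star x ∧ E * t * star x = E * t * star p := by
  have h1 : E * t * star x * star p = E * t * star x :=
    calc E * t * star x * star p = E * (x * t * star x * star p) := by
          nth_rw 1 [← hEx]; simp only [mul_assoc]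
      _ = E * p * x * t * star x := by
          rw [hM.transfer x t _ hx, star_star]; simp only [mul_assoc]
      _ = E * t * star x := by rw [hEp, hEx]
  refine ⟨h1, ?_⟩
  calc E * t * star x = E * (p * (t * star x) * star p) := by
        rw [← h1]; nth_rw 1 [← hEp]; simp only [mul_assoc]
    _ = E * p * x * star t * star p := by
        rw [hM.middle p _ hp, star_mul, star_star]; simp only [mul_assoc]
    _ = E * (p * star t * star p) := by
        rw [hEp, hEx]; nth_rw 1 [← hEp]; simp only [mul_assoc]
    _ = E * t * star p := by
        rw [← hM.middle p t hp]; nth_rw 2 [← hEp]; simp only [mul_assoc]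

/-- A factor in front of `X t X*` can be enclosed by the idempotent `X`. -/
lemma Laws.enclose {X : M} (hX : X ≠ 1) (hXX : X * X = X) (y t : M) :
    y * (X * t * star X) = X * y * X * t * star X := by
  have hs : star X * star X = star X := by rw [← star_mul, hXX]
  have h1 := hM.transfer X t (star y * star X) hX
  have h2 := hM.transfer X t (star y) hX
  rw [star_star] at h2
  calc y * (X * t * star X) = y * (X * t * star X) * star X := by
        simp only [mul_assoc, hs]
    _ = X * t * star X * (star y * star X) := by rw [← h2]; simp only [mul_assoc]
    _ = X * y * X * t * star X := by
        rw [h1, star_mul, star_star, star_star]; simp only [mul_assoc]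

/-- The value `x t x* x` is the zero `x x* x`. -/
lemma Laws.zigzag {x : M} (hx : x ≠ 1) (t : M) : x * t * star x * x = x * star x * x := by
  have hx' := star_ne_one hx
  have key : ∀ t : M, x * t * star x * x * star t = x * t * star x * x := by
    intro t
    have h1 : x * t * star x * x = star x * (x * star t) * star x := by
      have := hM.transfer (star x) 1 (star (x * t)) hx'
      simp only [star_star, mul_one] at this
      simp only [mul_assoc] at this ⊢
      rw [← this]; simp
    have h2 : x * star t * star x * x * star t = x * t * star x * x := by
      rw [h1, hM.braid _ _ hx' (hM.mul_ne_one hx)]; simp only [mul_assoc]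
    rwa [← hM.middle x t hx] at h2
  have key' : x * t * star x * x * t = x * t * star x * x := by
    have := key (star t)
    rwa [star_star, ← hM.middle x t hx] at this
  have h3 : x * t * star x * x * (t * star x) = x * t * star x * x := by
    simpa only [mul_assoc] using hM.sandwich_mul_inner hx (t * star x)
  calc x * t * star x * x = x * t * star x * (x * star x) := by
        rw [← mul_assoc (x * t * star x * x) t, key'] at h3
        rw [← mul_assoc (x * t * star x) x, h3]
    _ = x * star x * x * (t * star x) := by
        rw [hM.transfer x t _ hx, star_mul, star_star]; simp only [mul_assoc]
    _ = x * star x * x := hM.zero_mul x _ hx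

/-- A product in which a letter, its involute and the letter again occur in this order is a zero. -/
lemma Laws.isZero {x : M} (hx : x ≠ 1) (a s t b c : M) :
    a * (x * s * star x * t * x) * b * c = a * (x * s * star x * t * x) * b ∧
      c * (a * (x * s * star x * t * x) * b) = a * (x * s * star x * t * x) * b := by
  have h : a * (x * s * star x * t * x) * b = x * star x * x := by
    rw [hM.transfer x s t hx, mul_assoc (star t), hM.zigzag hx, hM.mul_zero x _ hx,
      hM.mul_zero x _ hx, hM.zero_mul x _ hx]
  rw [h]
  exact ⟨hM.zero_mul x c hx, hM.mul_zero x c hx⟩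

end Algebra

/-! ### Words and squares that absorb their letters -/

section Words

/-- A variable or its involute; `(n, true)` stands for the involute of the `n`-th variable. -/
abbrev Letter := ℕ × Bool

/-- The involute of a letter. -/
def bar (x : Letter) : Letter := (x.1, !x.2)

@[simp] lemma bar_bar (x : Letter) : bar (bar x) = x := by simp [bar]

lemma bar_ne (x : Letter) : bar x ≠ x := fun h => by
  have := congrArg Prod.snd h
  simp [bar] at this

lemma eq_or_eq_bar {x y : Letter} (h : x.1 = y.1) : x = y ∨ x = bar y := by
  rcases x with ⟨m, _ | _⟩ <;> rcases y with ⟨n, _ | _⟩ <;> simp_all [bar]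

/-- The involute of a word. -/
def barWord (w : List Letter) : List Letter := (w.map bar).reverse

variable {M : Type*} [Monoid M] [StarMul M]

/-- The value of a letter under an assignment of elements to the variables. -/
def letterVal (φ : ℕ → M) (x : Letter) : M := bif x.2 then star (φ x.1) else φ x.1

/-- The value of a word; the empty word has value `1`. -/
def wordVal (φ : ℕ → M) (w : List Letter) : M := (w.map (letterVal φ)).prod

lemma letterVal_bar (φ : ℕ → M) (x : Letter) : letterVal φ (bar x) = star (letterVal φ x) := by
  rcases x with ⟨n, _ | _⟩ <;> simp [letterVal, bar]

lemma letterVal_ne_one {φ : ℕ → M} (hφ : ∀ n, φ n ≠ 1) (x : Letter) : letterVal φ x ≠ 1 := by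
  rcases x with ⟨n, _ | _⟩
  · exact hφ n
  · exact star_ne_one (hφ n)

@[simp] lemma wordVal_nil (φ : ℕ → M) : wordVal φ [] = 1 := rfl

@[simp] lemma wordVal_cons (φ : ℕ → M) (x : Letter) (w : List Letter) :
    wordVal φ (x :: w) = letterVal φ x * wordVal φ w := by simp [wordVal]

@[simp] lemma wordVal_append (φ : ℕ → M) (u v : List Letter) :
    wordVal φ (u ++ v) = wordVal φ u * wordVal φ v := by simp [wordVal]

lemma wordVal_barWord (φ : ℕ → M) (w : List Letter) :
    wordVal φ (barWord w) = star (wordVal φ w) := by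
  induction w with
  | nil => simp [barWord]
  | cons x w ih =>
    have : barWord (x :: w) = barWord w ++ [bar x] := by simp [barWord]
    rw [this, wordVal_append, ih]
    simp [letterVal_bar]

/-- The square of the value of a word. It depends only on the set of letters of the word, and it
absorbs these letters on both sides. -/
def sqVal (φ : ℕ → M) (w : List Letter) : M := wordVal φ w * wordVal φ w

lemma absorb_word {φ : ℕ → M} {a : M} {w : List Letter}
    (h : ∀ x ∈ w, a * letterVal φ x = a) : a * wordVal φ w = a := by
  induction w with
  | nil => simp
  | cons x w ih =>
    rw [wordVal_cons, ← mul_assoc, h x (by simp)]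
    exact ih fun y hy => h y (by simp [hy])

lemma word_absorb {φ : ℕ → M} {a : M} {w : List Letter}
    (h : ∀ x ∈ w, letterVal φ x * a = a) : wordVal φ w * a = a := by
  induction w with
  | nil => simp
  | cons x w ih =>
    rw [wordVal_cons, mul_assoc, ih fun y hy => h y (by simp [hy])]
    exact h x (by simp)

variable (hM : Laws M) {φ : ℕ → M} (hφ : ∀ n, φ n ≠ 1)
include hM hφ

lemma wordVal_ne_one {w : List Letter} (hw : w ≠ []) : wordVal φ w ≠ 1 := by
  cases w with
  | nil => exact absurd rfl hw
  | cons x w => rw [wordVal_cons]; exact hM.mul_ne_one (letterVal_ne_one hφ x)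

lemma sqVal_ne_one {w : List Letter} (hw : w ≠ []) : sqVal φ w ≠ 1 :=
  hM.mul_ne_one (wordVal_ne_one hM hφ hw)

lemma sqVal_mul_prefix (p s : List Letter) :
    sqVal φ (p ++ s) * wordVal φ p = sqVal φ (p ++ s) := by
  induction p using List.reverseRecOn generalizing s with
  | nil => simp
  | append_singleton p x ih =>
    have h := ih (x :: s)
    rw [List.append_assoc, List.singleton_append, wordVal_append, ← mul_assoc, h]
    have hx := letterVal_ne_one hφ x
    simp only [sqVal, wordVal_append, wordVal_cons, wordVal_nil, mul_one] at h ⊢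
    generalize wordVal φ p = a at *
    generalize wordVal φ s = c at *
    generalize letterVal φ x = b at *
    have hN : a * (b * c) ≠ 1 := fun h1 => by
      have ha := hM.eq_one_of_mul_left _ _ h1
      rw [ha, one_mul] at h1
      exact hx (hM.eq_one_of_mul_left _ _ h1)
    have e1 : a * (b * c) * (a * (b * c)) = a * (b * c) * a * (b * (c * a) * b) := by
      calc a * (b * c) * (a * (b * c))
          = a * (b * c) * (a * (b * c)) * (a * (b * c)) * a := by
            rw [hM.cube _ hN, h]
        _ = a * (b * c) * a * (b * (c * a) * b * (c * a)) := by simp only [mul_assoc]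
        _ = _ := by rw [hM.sandwich_mul_inner hx]
    rw [e1, mul_assoc _ _ b, hM.sandwich_mul_outer hx]

lemma sqVal_mul_letter {w : List Letter} {x : Letter} (hx : x ∈ w) :
    sqVal φ w * letterVal φ x = sqVal φ w := by
  obtain ⟨p, s, rfl⟩ := List.append_of_mem hx
  have h1 := sqVal_mul_prefix hM hφ p (x :: s)
  have h2 := sqVal_mul_prefix hM hφ (p ++ [x]) s
  rw [List.append_assoc, List.singleton_append, wordVal_append, ← mul_assoc, h1] at h2
  simpa using h2

lemma letter_mul_sqVal {w : List Letter} {x : Letter} (hx : x ∈ w) :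
    letterVal φ x * sqVal φ w = sqVal φ w := by
  have h := sqVal_mul_letter hM hφ (w := barWord w) (x := bar x)
    (List.mem_reverse.2 (List.mem_map_of_mem hx))
  have h' := congrArg star h
  simpa [sqVal, wordVal_barWord, letterVal_bar] using h'

/-- A product of letters of `w` which absorbs all letters of `w` is the square of `w`. -/
lemma eq_sqVal {u w : List Letter} (hu : ∀ x ∈ u, x ∈ w)
    (h : ∀ x ∈ w, wordVal φ u * letterVal φ x = wordVal φ u) : wordVal φ u = sqVal φ w := by
  have h1 : wordVal φ u * sqVal φ w = wordVal φ u := by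
    rw [sqVal, ← mul_assoc, absorb_word h, absorb_word h]
  have h2 : wordVal φ u * sqVal φ w = sqVal φ w :=
    word_absorb fun x hx => letter_mul_sqVal hM hφ (hu x hx)
  exact h1.symm.trans h2

lemma sqVal_congr {u w : List Letter} (h : ∀ x, x ∈ u ↔ x ∈ w) : sqVal φ u = sqVal φ w := by
  have : wordVal φ (u ++ u) = sqVal φ w := eq_sqVal hM hφ (by simp [h]) fun x hx => by
    have := sqVal_mul_letter hM hφ ((h x).2 hx)
    simpa [sqVal] using this
  simpa [sqVal] using this

lemma sqVal_idem (w : List Letter) : sqVal φ w * sqVal φ w = sqVal φ w := by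
  have h : ∀ x ∈ w, sqVal φ w * letterVal φ x = sqVal φ w :=
    fun x hx => sqVal_mul_letter hM hφ hx
  nth_rw 2 [sqVal]
  rw [← mul_assoc, absorb_word h, absorb_word h]

/-- If `x` occurs on both sides of a word `s`, the enclosed factor is a square. -/
lemma sandwich_eq_sqVal (x : Letter) (s : List Letter) :
    letterVal φ x * wordVal φ s * letterVal φ x = sqVal φ (x :: s) := by
  rw [sqVal, wordVal_cons, ← mul_assoc, hM.sandwich_mul_inner (letterVal_ne_one hφ x)]

/-- An element which absorbs the letters of `q`, followed by a word that ends in a letter of `q`,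
absorbs all letters involved. -/
lemma absorb_extend {a : M} {q s : List Letter} {y x : Letter}
    (h : ∀ x ∈ q, a * letterVal φ x = a) (hy : y ∈ q) (hx : x ∈ q ++ s) :
    a * wordVal φ s * letterVal φ y * letterVal φ x = a * wordVal φ s * letterVal φ y := by
  have e : a * wordVal φ s * letterVal φ y = a * sqVal φ (y :: (q ++ s)) := by
    rw [← sandwich_eq_sqVal hM hφ, wordVal_append]
    calc a * wordVal φ s * letterVal φ y
        = a * letterVal φ y * wordVal φ q * wordVal φ s * letterVal φ y := by
          rw [h y hy, absorb_word h]
      _ = _ := by simp only [mul_assoc]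
  rw [e, mul_assoc, sqVal_mul_letter hM hφ (List.mem_cons_of_mem _ hx)]

lemma sqVal_mul_star_sqVal {q : List Letter} {x : Letter} (hx : x ∈ q)
    {a : M} (h : ∀ x ∈ q, a * letterVal φ x = a) (t : M) :
    a * t * star (sqVal φ q) = a * t * star (letterVal φ x) := by
  have hx1 := letterVal_ne_one hφ x
  have hq : q ≠ [] := List.ne_nil_of_mem hx
  refine ((hM.exchange hx1 (sqVal_ne_one hM hφ hq) (h x hx) ?_ t).2).symm
  rw [sqVal, ← mul_assoc, absorb_word h, absorb_word h]

end Words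


/-! ### Normal forms -/

section NormalForms

/-- A block is encoded by a list of letters. A singleton stands for its letter, any other list for
the square of its product; thus `[x, x]` encodes `x²`. -/
def blockWord (B : List Letter) : List Letter := if B.length = 1 then B else B ++ B

/-- The product of a list of blocks. -/
def tailWord (T : List (List Letter)) : List Letter := T.flatMap blockWord

/-- The involute of a product of blocks, as a list of blocks. -/
def barTail (T : List (List Letter)) : List (List Letter) := (T.map barWord).reverse

/-- A word is consistent if no letter occurs together with its involute. -/
def Consistent (w : List Letter) : Prop := ∀ x ∈ w, bar x ∉ w

/-- The data of a normal form: a list `Q` of letters and a list `T` of nonempty blocks, with no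
variable in common, and with no variable occurring both plain and starred. -/
structure IsNormal (Q : List Letter) (T : List (List Letter)) : Prop where
  consistent : Consistent (Q ++ T.flatten)
  disjoint : (Q :: T).Pairwise List.Disjoint
  ne_nil : [] ∉ T

lemma mem_blockWord {x : Letter} {B : List Letter} : x ∈ blockWord B ↔ x ∈ B := by
  unfold blockWord; split_ifs <;> simp

lemma mem_tailWord {x : Letter} {T : List (List Letter)} : x ∈ tailWord T ↔ x ∈ T.flatten := by
  simp [tailWord, mem_blockWord]

lemma mem_barWord {x : Letter} {w : List Letter} : x ∈ barWord w ↔ bar x ∈ w := by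
  simp only [barWord, List.mem_reverse, List.mem_map]
  exact ⟨by rintro ⟨y, hy, rfl⟩; simpa using hy, fun h => ⟨_, h, by simp⟩⟩

lemma mem_flatten_barTail {x : Letter} {T : List (List Letter)} :
    x ∈ (barTail T).flatten ↔ bar x ∈ T.flatten := by
  simp only [barTail, List.mem_flatten, List.mem_reverse, List.mem_map]
  constructor
  · rintro ⟨_, ⟨B, hB, rfl⟩, hx⟩
    exact ⟨B, hB, mem_barWord.1 hx⟩
  · rintro ⟨B, hB, hx⟩
    exact ⟨_, ⟨B, hB, rfl⟩, mem_barWord.2 hx⟩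

@[simp] lemma tailWord_nil : tailWord [] = [] := rfl

@[simp] lemma tailWord_cons (B : List Letter) (T : List (List Letter)) :
    tailWord (B :: T) = blockWord B ++ tailWord T := by simp [tailWord]

@[simp] lemma tailWord_append (S T : List (List Letter)) :
    tailWord (S ++ T) = tailWord S ++ tailWord T := by simp [tailWord]

variable {M : Type*} [Monoid M] [StarMul M]

/-- The element `E T E*` described by a normal form, where `E` is the square of `Q`. If `Q` is empty,
then this is the product of the blocks in `T`. -/
def normalVal (φ : ℕ → M) (Q : List Letter) (T : List (List Letter)) : M :=
  sqVal φ Q * wordVal φ (tailWord T) * star (sqVal φ Q)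

lemma normalVal_nil (φ : ℕ → M) (T : List (List Letter)) :
    normalVal φ [] T = wordVal φ (tailWord T) := by simp [normalVal, sqVal]

lemma wordVal_blockWord (φ : ℕ → M) {B : List Letter} (h : B.length ≠ 1) :
    wordVal φ (blockWord B) = sqVal φ B := by simp [blockWord, h, sqVal]

lemma wordVal_barTail (φ : ℕ → M) (T : List (List Letter)) :
    wordVal φ (tailWord (barTail T)) = star (wordVal φ (tailWord T)) := by
  induction T with
  | nil => simp [barTail]
  | cons B T ih =>
    have h1 : barTail (B :: T) = barTail T ++ [barWord B] := by simp [barTail]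
    have h2 : wordVal φ (blockWord (barWord B)) = star (wordVal φ (blockWord B)) := by
      have : (barWord B).length = B.length := by simp [barWord]
      unfold blockWord
      rw [this]
      split_ifs <;> simp [wordVal_barWord]
    rw [h1, tailWord_append, wordVal_append, ih]
    simp [h2]

lemma IsNormal.barTail {Q : List Letter} {T : List (List Letter)} (h : IsNormal Q T) :
    IsNormal Q (barTail T) := by
  obtain ⟨hc, hd, hn⟩ := h
  rw [List.pairwise_cons] at hd
  have hQT : ∀ x ∈ Q, x ∉ T.flatten := fun x hx hT => by
    obtain ⟨B, hB, hxB⟩ := List.mem_flatten.1 hT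
    exact hd.1 B hB hx hxB
  refine ⟨?_, ?_, ?_⟩
  · intro x hx hx'
    simp only [List.mem_append, mem_flatten_barTail, bar_bar] at hx hx'
    rcases hx with hx | hx <;> rcases hx' with hx' | hx'
    · exact hc x (by simp [hx]) (by simp [hx'])
    · exact hQT x hx hx'
    · exact hQT _ hx' hx
    · exact hc x (List.mem_append_right _ hx') (List.mem_append_right _ hx)
  · rw [List.pairwise_cons]
    constructor
    · intro B hB x hx hxB
      have : bar x ∈ T.flatten := mem_flatten_barTail.1 (List.mem_flatten.2 ⟨B, hB, hxB⟩)
      exact hc x (by simp [hx]) (List.mem_append_right _ this)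
    · rw [A0Words.barTail, List.pairwise_reverse, List.pairwise_map]
      refine hd.2.imp fun {a b} hab x hx hx' => ?_
      exact hab (mem_barWord.1 hx') (mem_barWord.1 hx)
  · intro h
    simp only [A0Words.barTail, List.mem_reverse, List.mem_map, barWord, List.reverse_eq_nil_iff,
      List.map_eq_nil_iff] at h
    obtain ⟨B, hB, rfl⟩ := h
    exact hn hB

variable (hM : Laws M) {φ : ℕ → M} (hφ : ∀ n, φ n ≠ 1)
include hM hφ

lemma normalVal_congr {Q Q' : List Letter} (h : ∀ x, x ∈ Q ↔ x ∈ Q') (T : List (List Letter)) :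
    normalVal φ Q T = normalVal φ Q' T := by
  rw [normalVal, normalVal, sqVal_congr hM hφ h]

lemma normalVal_barTail {Q : List Letter} (hQ : Q ≠ []) (T : List (List Letter)) :
    normalVal φ Q (barTail T) = normalVal φ Q T := by
  rw [normalVal, wordVal_barTail, ← hM.middle _ _ (sqVal_ne_one hM hφ hQ), normalVal]

/-- The closing factor `E*` only has to match a part of the opening factor. -/
lemma close_eq {q r : List Letter} {y : Letter} (hy : y ∈ q) (hqr : ∀ x ∈ q, x ∈ r) (t : M) :
    sqVal φ r * t * star (sqVal φ q) = sqVal φ r * t * star (sqVal φ r) := by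
  rw [sqVal_mul_star_sqVal hM hφ hy fun x hx => sqVal_mul_letter hM hφ (hqr x hx),
    sqVal_mul_star_sqVal hM hφ (hqr y hy) fun x hx => sqVal_mul_letter hM hφ hx]

lemma letter_mul_normalVal {Q : List Letter} (hQ : Q ≠ []) (y : Letter) (T : List (List Letter)) :
    letterVal φ y * normalVal φ Q T = normalVal φ (y :: Q) T := by
  obtain ⟨q, hq⟩ := List.exists_mem_of_ne_nil Q hQ
  have hX := sqVal_ne_one hM hφ hQ
  have e : sqVal φ Q * letterVal φ y * sqVal φ Q = sqVal φ (y :: Q) := by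
    have : wordVal φ ((Q ++ Q) ++ y :: (Q ++ Q)) = sqVal φ (y :: Q) := by
      refine eq_sqVal hM hφ (by intro x; simp; tauto) fun x hx => ?_
      have e' : wordVal φ ((Q ++ Q) ++ y :: (Q ++ Q))
          = sqVal φ Q * letterVal φ y * sqVal φ Q := by simp [sqVal, mul_assoc]
      rw [e']
      rcases List.mem_cons.1 hx with rfl | hx
      · exact hM.sandwich_mul_inner hX _
      · rw [mul_assoc, sqVal_mul_letter hM hφ hx]
    rw [← this]; simp [sqVal, mul_assoc]
  rw [normalVal, hM.enclose hX (sqVal_idem hM hφ Q), e,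
    close_eq hM hφ hq fun x hx => List.mem_cons_of_mem _ hx, normalVal]

lemma word_mul_normalVal {Q : List Letter} (hQ : Q ≠ []) (p : List Letter)
    (T : List (List Letter)) :
    wordVal φ p * normalVal φ Q T = normalVal φ (p ++ Q) T := by
  induction p with
  | nil => simp
  | cons y p ih =>
    rw [wordVal_cons, mul_assoc, ih, letter_mul_normalVal hM hφ (by simp [hQ])]
    rfl

lemma normalVal_mul_letter {Q : List Letter} (hQ : Q ≠ []) (x : Letter) (T : List (List Letter)) :
    normalVal φ Q T * letterVal φ x = normalVal φ (bar x :: Q) T := by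
  rw [← letter_mul_normalVal hM hφ hQ, letterVal_bar, normalVal,
    hM.transfer _ _ _ (sqVal_ne_one hM hφ hQ)]

/-- Appending a letter of `Q` turns a normal form into a zero. -/
lemma normalVal_mul_zero {Q : List Letter} {x : Letter} (hx : x ∈ Q) (T : List (List Letter))
    (c : M) : normalVal φ Q T * letterVal φ x * c = normalVal φ Q T * letterVal φ x ∧
      c * (normalVal φ Q T * letterVal φ x) = normalVal φ Q T * letterVal φ x := by
  have hr := sqVal_mul_letter hM hφ hx
  have hs : star (sqVal φ Q) = star (letterVal φ x) * star (sqVal φ Q) := by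
    rw [← star_mul, hr]
  have e : normalVal φ Q T * letterVal φ x = sqVal φ Q * (letterVal φ x * wordVal φ (tailWord T) *
      star (letterVal φ x) * star (sqVal φ Q) * letterVal φ x) * 1 := by
    rw [normalVal]
    nth_rw 1 [hs, ← hr]
    simp only [mul_assoc, mul_one]
  rw [e]
  exact hM.isZero (letterVal_ne_one hφ x) _ _ _ _ c

/-- If a letter recurs, then the blocks from its first occurrence on merge into one. -/
lemma merge_blocks {B : List Letter} {x : Letter} (hx : x ∈ B) (S : List (List Letter)) :
    wordVal φ (tailWord (B :: S)) * letterVal φ x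
      = wordVal φ (blockWord (x :: B ++ S.flatten)) := by
  rw [wordVal_blockWord φ (by
    have := List.length_pos_of_mem hx
    simp only [List.length_append, List.length_cons]
    omega)]
  by_cases hB : B.length = 1
  · obtain ⟨y, rfl⟩ := List.length_eq_one_iff.1 hB
    obtain rfl : x = y := by simpa using hx
    have : wordVal φ (tailWord ([x] :: S)) * letterVal φ x
        = letterVal φ x * wordVal φ (tailWord S) * letterVal φ x := by simp [blockWord]
    rw [this, sandwich_eq_sqVal hM hφ]
    exact sqVal_congr hM hφ fun y => by
      rw [List.mem_cons, mem_tailWord, List.mem_append, List.mem_cons, List.mem_singleton,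
        or_self]
  · have e : wordVal φ ((B ++ B) ++ tailWord S ++ [x])
        = sqVal φ B * wordVal φ (tailWord S) * letterVal φ x := by simp [sqVal, mul_assoc]
    rw [tailWord_cons, wordVal_append, wordVal_blockWord φ hB, ← e]
    refine eq_sqVal hM hφ (fun y hy => ?_) fun y hy => ?_
    · simp only [List.mem_append, mem_tailWord, List.mem_cons] at hy ⊢
      tauto
    · rw [e]
      refine absorb_extend hM hφ (q := B) (fun z hz => sqVal_mul_letter hM hφ hz) hx ?_
      simp only [List.mem_append, mem_tailWord, List.cons_append, List.mem_cons] at hy ⊢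
      rcases hy with rfl | hy
      · exact Or.inl hx
      · exact hy

/-- The first letter whose involute occurs before it creates a normal form with nonempty `Q`. -/
lemma plain_mul_bar {B : List Letter} {y : Letter} (hy : y ∈ B) (P S : List (List Letter)) :
    normalVal φ [] (P ++ B :: S) * letterVal φ (bar y) = normalVal φ (P.flatten ++ B) S := by
  have h1 : wordVal φ (blockWord B) * wordVal φ (tailWord S) * star (letterVal φ y)
      = normalVal φ B S := by
    rw [normalVal, sqVal_mul_star_sqVal hM hφ hy fun x hx => sqVal_mul_letter hM hφ hx]
    by_cases hB : B.length = 1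
    · obtain ⟨z, rfl⟩ := List.length_eq_one_iff.1 hB
      obtain rfl : y = z := by simpa using hy
      simpa [blockWord, sqVal] using
        (hM.square_left (letterVal φ y) (wordVal φ (tailWord S)) (letterVal_ne_one hφ y)).symm
    · rw [wordVal_blockWord φ hB]
  rw [normalVal_nil, letterVal_bar, tailWord_append, tailWord_cons, wordVal_append, wordVal_append,
    mul_assoc, h1, word_mul_normalVal hM hφ (List.ne_nil_of_mem hy)]
  exact normalVal_congr hM hφ (fun x => by simp only [List.mem_append, mem_tailWord]) S

/-- A block containing a letter of `Q` is absorbed by `Q`, with everything before it. -/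
lemma normalVal_absorb {Q B : List Letter} {y : Letter} (hQ : y ∈ Q) (hB : y ∈ B)
    (P S : List (List Letter)) :
    normalVal φ Q (P ++ B :: S) = normalVal φ (Q ++ P.flatten ++ B) S := by
  obtain ⟨u, hu, hu'⟩ : ∃ u : List Letter, (∀ x, x ∈ B ↔ x ∈ u ∨ x = y) ∧
      wordVal φ (blockWord B) = wordVal φ u * letterVal φ y := by
    by_cases h : B.length = 1
    · obtain ⟨z, rfl⟩ := List.length_eq_one_iff.1 h
      obtain rfl : y = z := by simpa using hB
      exact ⟨[], by simp, by simp [blockWord]⟩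
    · refine ⟨B ++ B, fun x => ?_, ?_⟩
      · simp only [List.mem_append, or_self]
        exact ⟨Or.inl, fun h => h.elim id fun h => h ▸ hB⟩
      · rw [wordVal_append, ← sqVal, sqVal_mul_letter hM hφ hB, wordVal_blockWord φ h]
  have e : wordVal φ ((Q ++ Q) ++ tailWord P ++ blockWord B)
      = sqVal φ Q * wordVal φ (tailWord P ++ u) * letterVal φ y := by
    simp [sqVal, hu', mul_assoc]
  have e' : wordVal φ ((Q ++ Q) ++ tailWord P ++ blockWord B) = sqVal φ (Q ++ P.flatten ++ B) := by
    refine eq_sqVal hM hφ (fun x hx => ?_) fun x hx => ?_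
    · simpa only [List.mem_append, mem_tailWord, mem_blockWord, or_self] using hx
    · rw [e]
      refine absorb_extend hM hφ (fun z hz => sqVal_mul_letter hM hφ hz) hQ ?_
      simp only [List.mem_append, hu, mem_tailWord] at hx ⊢
      rcases hx with (hx | hx) | hx | rfl <;> tauto
  rw [normalVal, normalVal, ← close_eq hM hφ hQ (r := Q ++ P.flatten ++ B)
    (fun x hx => by simp [hx]), ← e']
  simp [sqVal, mul_assoc]

end NormalForms

/-! ### Reduction of words to normal form -/

section Reduction

/-- The word is a zero of every model. -/
def IsZeroWord (w : List Letter) : Prop :=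
  ∀ (M : Type) [Monoid M] [StarMul M], Laws M → ∀ φ : ℕ → M, (∀ n, φ n ≠ 1) →
    ∀ c, wordVal φ w * c = wordVal φ w ∧ c * wordVal φ w = wordVal φ w

/-- In every model, the word has the value described by `Q` and `T`. -/
def HasForm (w Q : List Letter) (T : List (List Letter)) : Prop :=
  ∀ (M : Type) [Monoid M] [StarMul M], Laws M → ∀ φ : ℕ → M, (∀ n, φ n ≠ 1) →
    wordVal φ w = normalVal φ Q T

lemma IsNormal.absorb {Q B P' : List Letter} {P S : List (List Letter)}
    (h : IsNormal Q (P ++ B :: S)) (hP' : ∀ x ∈ P', x ∈ Q ++ P.flatten ++ B) :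
    IsNormal P' S := by
  obtain ⟨hc, hd, hn⟩ := h
  have hsub : ∀ x ∈ P' ++ S.flatten, x ∈ Q ++ (P ++ B :: S).flatten := by
    intro x hx
    rcases List.mem_append.1 hx with hx | hx
    · have := hP' x hx
      simp only [List.mem_append, List.flatten_append, List.flatten_cons] at this ⊢
      tauto
    · simp only [List.mem_append, List.flatten_append, List.flatten_cons]
      tauto
  refine ⟨fun x hx hx' => hc x (hsub x hx) (hsub _ hx'), ?_, fun h => hn (by simp [h])⟩
  simp only [List.pairwise_cons, List.pairwise_append, List.mem_append, List.mem_cons] at hd ⊢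
  refine ⟨fun C hC x hx hxC => ?_, hd.2.2.1.2⟩
  have := hP' x hx
  simp only [List.mem_append, List.mem_flatten] at this
  rcases this with (hx | ⟨D, hD, hx⟩) | hx
  · exact hd.1 C (Or.inr (Or.inr hC)) hx hxC
  · exact hd.2.2.2 D hD C (Or.inr hC) hx hxC
  · exact hd.2.2.1.1 C hC hx hxC

/-- Every word is a zero or has a normal form. -/
theorem exists_form (w : List Letter) :
    IsZeroWord w ∨ ∃ Q T, IsNormal Q T ∧ HasForm w Q T := by
  induction w using List.reverseRecOn with
  | nil =>
    exact Or.inr ⟨[], [], ⟨by simp [Consistent], by simp, by simp⟩, fun M _ _ _ φ _ => by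
      simp [normalVal_nil]⟩
  | append_singleton w x ih =>
    rcases ih with hz | ⟨Q, T, hN, hF⟩
    · refine Or.inl fun M _ _ hM φ hφ c => ?_
      have h := hz M hM φ hφ
      have e : wordVal φ (w ++ [x]) = wordVal φ w := by simpa using (h (letterVal φ x)).1
      rw [e]; exact h c
    have hsplit : ∀ {y : Letter} {T : List (List Letter)}, y ∈ T.flatten →
        ∃ P B S, T = P ++ B :: S ∧ y ∈ B := by
      intro y T hy
      obtain ⟨B, hB, hyB⟩ := List.mem_flatten.1 hy
      obtain ⟨P, S, rfl⟩ := List.append_of_mem hB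
      exact ⟨P, B, S, rfl, hyB⟩
    by_cases hQ : Q = []
    · subst hQ
      refine Or.inr ?_
      by_cases hx : x ∈ T.flatten
      · obtain ⟨P, B, S, rfl, hxB⟩ := hsplit hx
        refine ⟨[], P ++ [x :: B ++ S.flatten], ?_, fun M _ _ hM φ hφ => ?_⟩
        · obtain ⟨hc, hd, hn⟩ := hN
          have hsub : ∀ z ∈ [] ++ (P ++ [x :: B ++ S.flatten]).flatten,
              z ∈ [] ++ (P ++ B :: S).flatten := by
            intro z hz
            simp only [List.nil_append, List.flatten_append, List.flatten_cons, List.flatten_nil,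
              List.mem_append, List.cons_append, List.mem_cons, List.append_nil] at hz ⊢
            rcases hz with hz | rfl | hz <;> tauto
          refine ⟨fun z hz hz' => hc z (hsub z hz) (hsub _ hz'), ?_, ?_⟩
          · simp only [List.pairwise_cons, List.pairwise_append, List.mem_append, List.mem_cons]
              at hd ⊢
            refine ⟨by simp, hd.2.1, by simp, fun C hC D hD z hz hz' => ?_⟩
            obtain rfl : D = x :: B ++ S.flatten := by simpa using hD
            simp only [List.cons_append, List.mem_cons, List.mem_append, List.mem_flatten] at hz'
            rcases hz' with rfl | hz' | ⟨D, hD, hz'⟩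
            · exact hd.2.2.2 C hC B (Or.inl rfl) hz hxB
            · exact hd.2.2.2 C hC B (Or.inl rfl) hz hz'
            · exact hd.2.2.2 C hC D (Or.inr hD) hz hz'
          · simp only [List.mem_append, List.mem_cons] at hn ⊢
            simp only [List.cons_append, List.not_mem_nil, or_false, reduceCtorEq]
            tauto
        · have h := merge_blocks hM hφ hxB S
          rw [wordVal_append, hF M hM φ hφ, normalVal_nil, normalVal_nil, tailWord_append,
            tailWord_append, wordVal_append, wordVal_append, wordVal_cons, wordVal_nil, mul_one,
            mul_assoc, h]
          simp
      by_cases hx' : bar x ∈ T.flatten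
      · obtain ⟨P, B, S, rfl, hxB⟩ := hsplit hx'
        refine ⟨P.flatten ++ B, S, hN.absorb (by simp), fun M _ _ hM φ hφ => ?_⟩
        rw [← plain_mul_bar hM hφ hxB, wordVal_append, hF M hM φ hφ]
        simp
      · refine ⟨[], T ++ [[x]], ?_, fun M _ _ hM φ hφ => ?_⟩
        · obtain ⟨hc, hd, hn⟩ := hN
          refine ⟨fun z hz hz' => ?_, ?_, by simpa using hn⟩
          · simp only [List.nil_append, List.flatten_append, List.flatten_cons, List.flatten_nil,
              List.mem_append, List.append_nil, List.mem_singleton] at hz hz'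
            rcases hz with hz | rfl <;> rcases hz' with hz' | hz'
            · exact hc z hz hz'
            · rw [← hz', bar_bar] at hx'; exact hx' hz
            · exact hx' hz'
            · exact bar_ne _ hz'
          · simp only [List.pairwise_cons, List.pairwise_append] at hd ⊢
            refine ⟨by simp, hd.2, by simp, fun C hC D hD z hz hz' => ?_⟩
            obtain rfl : D = [x] := by simpa using hD
            obtain rfl : z = x := by simpa using hz'
            exact hx (List.mem_flatten.2 ⟨C, hC, hz⟩)
        · rw [wordVal_append, hF M hM φ hφ, normalVal_nil, normalVal_nil]
          simp [blockWord]
    have hF' : ∀ (M : Type) [Monoid M] [StarMul M], Laws M → ∀ φ : ℕ → M, (∀ n, φ n ≠ 1) →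
        wordVal φ (w ++ [x]) = normalVal φ (bar x :: Q) T := by
      intro M _ _ hM φ hφ
      rw [← normalVal_mul_letter hM hφ hQ, wordVal_append, hF M hM φ hφ]
      simp
    by_cases hxQ : x ∈ Q
    · refine Or.inl fun M _ _ hM φ hφ c => ?_
      rw [hF' M hM φ hφ, ← normalVal_mul_letter hM hφ hQ]
      exact normalVal_mul_zero hM hφ hxQ T c
    refine Or.inr ?_
    -- If `bar x` lies in a block of `T`, then it is absorbed; if `x` does, `T` is reversed first.
    have absorbed : ∀ T, IsNormal Q T → bar x ∈ T.flatten → HasForm (w ++ [x]) (bar x :: Q) T →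
        ∃ Q T, IsNormal Q T ∧ HasForm (w ++ [x]) Q T := by
      intro T hN hx hF
      obtain ⟨P, B, S, rfl, hxB⟩ := hsplit hx
      refine ⟨bar x :: Q ++ P.flatten ++ B, S, hN.absorb fun z hz => ?_, fun M _ _ hM φ hφ => ?_⟩
      · simp only [List.cons_append, List.mem_cons, List.mem_append] at hz ⊢
        rcases hz with rfl | hz
        · exact Or.inr hxB
        · exact hz
      · rw [hF M hM φ hφ, normalVal_absorb hM hφ (by simp) hxB]
    by_cases hx : bar x ∈ T.flatten
    · exact absorbed T hN hx hF'
    by_cases hx' : x ∈ T.flatten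
    · refine absorbed (barTail T) hN.barTail (mem_flatten_barTail.2 (by simpa using hx'))
        fun M _ _ hM φ hφ => ?_
      rw [normalVal_barTail hM hφ (by simp), hF' M hM φ hφ]
    · refine ⟨bar x :: Q, T, ?_, hF'⟩
      obtain ⟨hc, hd, hn⟩ := hN
      refine ⟨fun z hz hz' => ?_, ?_, hn⟩
      · simp only [List.cons_append, List.mem_cons, List.mem_append] at hz hz'
        rcases hz with rfl | hz <;> rcases hz' with hz' | hz'
        · exact bar_ne _ hz'
        · rw [bar_bar] at hz'; tauto
        · have : z = x := by rw [← bar_bar z, hz', bar_bar]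
          subst this; tauto
        · exact hc z (List.mem_append.2 hz) (List.mem_append.2 hz')
      · simp only [List.pairwise_cons] at hd ⊢
        refine ⟨fun C hC z hz hz' => ?_, hd.2⟩
        rcases List.mem_cons.1 hz with rfl | hz
        · exact hx (List.mem_flatten.2 ⟨C, hC, hz'⟩)
        · exact hd.1 C hC hz hz'

end Reduction


/-! ### Adjoining an identity element -/

section AdjoinOne

/-- The involution of a semigroup, extended by `1* = 1` to the monoid with adjoined identity. -/
instance {S : Type*} [Semigroup S] [StarMul S] : StarMul (WithOne S) where
  star a := WithOne.recOneCoe 1 (fun s => ((star s : S) : WithOne S)) a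
  star_involutive a := by
    induction a with
    | one => rfl
    | coe a => exact congrArg WithOne.coe (star_star a)
  star_mul a b := by
    induction a with
    | one => simp
    | coe a =>
      induction b with
      | one => simp
      | coe b => exact congrArg WithOne.coe (star_mul a b)

lemma coe_star {S : Type*} [Semigroup S] [StarMul S] (a : S) :
    ((star a : S) : WithOne S) = star (a : WithOne S) := rfl

open A0Basis in
/-- If a semigroup satisfies the identities of the basis, then the laws hold after adjoining `1`. -/
theorem laws_withOne {S : Type*} [Semigroup S] [StarMul S]
    (h : ∀ e ∈ a0Basis, e.SatisfiedBy S) : Laws (WithOne S) := by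
  have asg : ∀ e ∈ a0Basis, ∀ a b c : S,
      e.lhs.eval (fun n => if n = 0 then a else if n = 1 then b else c) =
      e.rhs.eval (fun n => if n = 0 then a else if n = 1 then b else c) := fun e he a b c => h e he _
  simp only [a0Basis, A0Basis.involution, zero, middle, transfer, square, plain, Set.mem_union,
    Set.mem_insert_iff, Set.mem_singleton_iff, or_imp, forall_and, forall_eq] at asg
  obtain ⟨⟨⟨⟨⟨-, z1, z2⟩, m⟩, t1, t2⟩, s1, s2, s3, s4⟩, p1, p2, p3⟩ := asg
  have hi : ∀ s : InvTerm, star s = InvTerm.inv s := fun _ => rfl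
  simp only [A0Basis.x, A0Basis.y, A0Basis.T, hi, InvTerm.eval, if_true, one_ne_zero, if_false,
    OfNat.ofNat_ne_zero, OfNat.ofNat_ne_one] at z1 z2 m t1 t2 s1 s2 s3 s4 p1 p2 p3
  refine ⟨?_, ?_, ?_, ?_, ?_, ?_, ?_, ?_, ?_, ?_⟩
  · intro a b hab
    induction a with
    | one => rfl
    | coe a =>
      induction b with
      | one => exact absurd hab (by simp)
      | coe b => exact absurd hab (by rw [← WithOne.coe_mul]; exact WithOne.coe_ne_one)
  · intro x y hx
    lift x to S using hx
    induction y with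
    | one => simp
    | coe y => simpa only [← coe_star, ← WithOne.coe_mul, WithOne.coe_inj] using z1 x y y
  · intro x y hx
    lift x to S using hx
    induction y with
    | one => simp
    | coe y => simpa only [← coe_star, ← WithOne.coe_mul, WithOne.coe_inj] using (z2 x y y).symm
  · intro x y hx
    lift x to S using hx
    induction y with
    | one => simp
    | coe y => simpa only [← coe_star, ← WithOne.coe_mul, WithOne.coe_inj] using m x y y
  · intro x t y hx
    lift x to S using hx
    induction y with
    | one => simp
    | coe y =>
      induction t with
      | one =>
        simpa only [← coe_star, ← WithOne.coe_mul, WithOne.coe_inj, mul_one, mul_assoc]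
          using t2 x y y
      | coe t =>
        simpa only [← coe_star, ← WithOne.coe_mul, WithOne.coe_inj, mul_assoc] using t1 x y t
  · intro x t hx
    lift x to S using hx
    induction t with
    | one => simpa only [← coe_star, ← WithOne.coe_mul, WithOne.coe_inj, mul_one] using s3 x x x
    | coe t => simpa only [← coe_star, ← WithOne.coe_mul, WithOne.coe_inj] using s1 x x t
  · intro x t hx
    lift x to S using hx
    induction t with
    | one =>
      simpa only [← coe_star, ← WithOne.coe_mul, WithOne.coe_inj, mul_one] using (s4 x x x).symm
    | coe t => simpa only [← coe_star, ← WithOne.coe_mul, WithOne.coe_inj] using (s2 x x t).symm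
  · intro x hx
    lift x to S using hx
    simpa only [← WithOne.coe_mul, WithOne.coe_inj] using (p1 x x x).symm
  · intro x y hx hy
    lift x to S using hx
    lift y to S using hy
    simpa only [← WithOne.coe_mul, WithOne.coe_inj] using p2 x y y
  · intro x y hx hy
    lift x to S using hx
    lift y to S using hy
    simpa only [← WithOne.coe_mul, WithOne.coe_inj] using ((p2 x y y).trans (p3 x y y)).symm

end AdjoinOne

/-! ### The semigroup `A₀` -/

section Separation

theorem a0_satisfies : ∀ d ∈ a0Basis, d.SatisfiedBy A0 := by
  intro d hd φ
  simp only [a0Basis, A0Basis.involution, A0Basis.zero, A0Basis.middle, A0Basis.transfer,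
    A0Basis.square, A0Basis.plain, Set.mem_union, Set.mem_insert_iff, Set.mem_singleton_iff] at hd
  have hi : ∀ s : InvTerm, (star s).eval φ = star (s.eval φ) := fun _ => rfl
  rcases hd with (((((rfl | rfl) | rfl | rfl) | rfl) | rfl | rfl) | rfl | rfl | rfl | rfl) |
      rfl | rfl | rfl <;>
    simp only [A0Basis.x, A0Basis.y, A0Basis.T, hi, InvTerm.eval] <;>
    generalize φ 0 = a <;> generalize φ 1 = b <;> generalize φ 2 = c <;>
    cases a <;> cases b <;> cases c <;> rfl

instance : DecidableEq A0 := fun a b => by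
  cases a <;> cases b <;> first | exact isTrue rfl | exact isFalse (fun h => nomatch h)

instance : Fintype A0 := ⟨{.e1, .e2, .e3, .e4}, fun a => by cases a <;> decide⟩

/-- The semigroup `A₀` with an identity element adjoined. -/
abbrev A0One := WithOne A0

instance : DecidableEq A0One := inferInstanceAs (DecidableEq (Option A0))

instance : Fintype A0One := inferInstanceAs (Fintype (Option A0))

/-- The zero element `2` of `A₀`. -/
def zeroElt : A0One := (A0.e2 : A0One)

/-- The idempotent `3` of `A₀`. -/
def lastElt : A0One := (A0.e3 : A0One)

/-- The idempotent `4` of `A₀`. Among products of copies of `3` and `4`, those that are not zero are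
`3`, `4` and `4 · 3 = 1`: all factors `4` precede all factors `3`. -/
def firstElt : A0One := (A0.e4 : A0One)

lemma ne_zero_of_mul : ∀ a b : A0One, a * b ≠ zeroElt → a ≠ zeroElt ∧ b ≠ zeroElt := by decide

lemma eq_of_mul_eq : ∀ c : A0One, c = firstElt ∨ c = lastElt → ∀ a b : A0One, a * b = c →
    (a = 1 ∨ a = c) ∧ (b = 1 ∨ b = c) := by decide

lemma eq_of_sq_ne : ∀ a : A0One, a * a ≠ zeroElt → a = 1 ∨ a = firstElt ∨ a = lastElt := by decide

lemma last_mul : ∀ b : A0One, lastElt * b ≠ zeroElt → b = 1 ∨ b = lastElt := by decide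

lemma first_mul : ∀ b : A0One, firstElt * b ≠ zeroElt ↔ b ≠ zeroElt := by decide

lemma last_conj : ∀ b : A0One, lastElt * b * star lastElt = zeroElt := by decide

lemma first_conj : ∀ b : A0One, firstElt * b * star firstElt ≠ zeroElt ↔ b ≠ zeroElt := by decide

lemma mul_zeroElt : ∀ b : A0One, b * zeroElt = zeroElt := by decide

lemma star_ne_zeroElt : ∀ b : A0One, star b ≠ zeroElt ↔ b ≠ zeroElt := by decide

end Separation


/-! ### Assignments in `A₀` with nonzero value -/

section Assignments

lemma laws_a0One : Laws A0One := laws_withOne a0_satisfies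

variable {φ ψ : ℕ → A0One}

lemma letterVal_congr {x : Letter} (h : φ x.1 = ψ x.1) : letterVal φ x = letterVal ψ x := by
  simp [letterVal, h]

lemma wordVal_congr {w : List Letter} (h : ∀ x ∈ w, letterVal φ x = letterVal ψ x) :
    wordVal φ w = wordVal ψ w := congrArg List.prod (List.map_congr_left h)

lemma tail_congr {T : List (List Letter)}
    (h : ∀ x ∈ T.flatten, letterVal φ x = letterVal ψ x) :
    wordVal φ (tailWord T) = wordVal ψ (tailWord T) :=
  wordVal_congr fun x hx => h x (mem_tailWord.1 hx)

lemma letterVal_ne_zeroElt {w : List Letter} (hw : wordVal φ w ≠ zeroElt) {x : Letter}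
    (hx : x ∈ w) : letterVal φ x ≠ zeroElt := by
  obtain ⟨p, s, rfl⟩ := List.append_of_mem hx
  rw [wordVal_append, wordVal_cons] at hw
  exact (ne_zero_of_mul _ _ (ne_zero_of_mul _ _ hw).2).1

/-- The idempotents `3` and `4`. -/
def IsIdem (c : A0One) : Prop := c = firstElt ∨ c = lastElt

lemma IsIdem.mul_self {c : A0One} (hc : IsIdem c) : c * c = c := by
  rcases hc with rfl | rfl <;> decide

lemma IsIdem.ne_zeroElt {c : A0One} (hc : IsIdem c) : c ≠ zeroElt := by
  rcases hc with rfl | rfl <;> decide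

lemma first_ne_last : firstElt ≠ lastElt := by decide

lemma wordVal_const {c : A0One} (hc : IsIdem c) {w : List Letter}
    (h : ∀ x ∈ w, letterVal φ x = c) : w = [] ∨ wordVal φ w = c := by
  induction w with
  | nil => exact Or.inl rfl
  | cons x w ih =>
    refine Or.inr ?_
    rw [wordVal_cons, h x (by simp)]
    rcases ih fun y hy => h y (by simp [hy]) with rfl | h'
    · simp
    · rw [h', hc.mul_self]

lemma wordVal_const_ne {c : A0One} (hc : IsIdem c) {w : List Letter}
    (h : ∀ x ∈ w, letterVal φ x = c) : wordVal φ w ≠ zeroElt := by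
  rcases wordVal_const hc h with rfl | h
  · rw [wordVal_nil]; decide
  · rw [h]; exact hc.ne_zeroElt

lemma letterVal_eq_of_wordVal (hφ : ∀ n, φ n ≠ 1) {c : A0One} (hc : IsIdem c)
    {w : List Letter} (h : wordVal φ w = 1 ∨ wordVal φ w = c) : ∀ x ∈ w, letterVal φ x = c := by
  induction w with
  | nil => simp
  | cons x w ih =>
    have h' := h.resolve_left (wordVal_ne_one laws_a0One hφ (by simp))
    rw [wordVal_cons] at h'
    obtain ⟨h1, h2⟩ := eq_of_mul_eq c hc _ _ h'
    intro y hy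
    rcases List.mem_cons.1 hy with rfl | hy
    · exact h1.resolve_left (letterVal_ne_one hφ y)
    · exact ih h2 y hy

lemma letterVal_eq_of_sq (hφ : ∀ n, φ n ≠ 1) {w : List Letter}
    (h : sqVal φ w ≠ zeroElt) : ∃ c, IsIdem c ∧ ∀ x ∈ w, letterVal φ x = c := by
  rcases eq_of_sq_ne _ h with h | h | h
  · exact ⟨_, Or.inl rfl, letterVal_eq_of_wordVal hφ (Or.inl rfl) (Or.inl h)⟩
  · exact ⟨_, Or.inl rfl, letterVal_eq_of_wordVal hφ (Or.inl rfl) (Or.inr h)⟩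
  · exact ⟨_, Or.inr rfl, letterVal_eq_of_wordVal hφ (Or.inr rfl) (Or.inr h)⟩

/-- The letters of a block with nonzero value all have the same value: a nonzero square in `A₀` is
idempotent, and the idempotents `3` and `4` are products of copies of themselves only. -/
lemma block_const (hφ : ∀ n, φ n ≠ 1) {B : List Letter} (h : wordVal φ (blockWord B) ≠ zeroElt)
    {y : Letter} (hy : y ∈ B) : ∀ x ∈ B, letterVal φ x = letterVal φ y := by
  by_cases hB : B.length = 1
  · obtain ⟨z, rfl⟩ := List.length_eq_one_iff.1 hB
    intro x hx
    rw [List.mem_singleton.1 hx, List.mem_singleton.1 hy]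
  · rw [wordVal_blockWord φ hB] at h
    obtain ⟨c, -, h⟩ := letterVal_eq_of_sq hφ h
    intro x hx
    rw [h x hx, h y hy]

/-- In a nonzero product, nothing but `3` can follow a block with value `3`. -/
lemma tail_eq_last (hφ : ∀ n, φ n ≠ 1) {B : List Letter} {R : List (List Letter)}
    (h : wordVal φ (tailWord (B :: R)) ≠ zeroElt) {y : Letter} (hy : y ∈ B)
    (hyv : letterVal φ y = lastElt) : ∀ x ∈ (B :: R).flatten, letterVal φ x = lastElt := by
  rw [tailWord_cons, wordVal_append] at h
  have hB : ∀ x ∈ B, letterVal φ x = lastElt := fun x hx => by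
    rw [block_const hφ (ne_zero_of_mul _ _ h).1 hy x hx, hyv]
  have hBv := (wordVal_const (Or.inr rfl) fun x hx => hB x (mem_blockWord.1 hx)).resolve_left
    (List.ne_nil_of_mem (mem_blockWord.2 hy))
  rw [hBv] at h
  intro x hx
  rcases List.mem_append.1 (List.flatten_cons ▸ hx) with hx | hx
  · exact hB x hx
  · exact letterVal_eq_of_wordVal hφ (Or.inr rfl) (last_mul _ h) x (mem_tailWord.2 hx)

lemma first_block_mul {B : List Letter} {R : List (List Letter)}
    (hB : ∀ x ∈ B, letterVal φ x = firstElt) :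
    wordVal φ (tailWord (B :: R)) ≠ zeroElt ↔ wordVal φ (tailWord R) ≠ zeroElt := by
  rw [tailWord_cons, wordVal_append]
  rcases wordVal_const (φ := φ) (Or.inl rfl) fun x hx => hB x (mem_blockWord.1 hx) with h | h
  · rw [h, wordVal_nil, one_mul]
  · rw [h, first_mul]

lemma normalVal_ne_zeroElt (hφ : ∀ n, φ n ≠ 1) (Q : List Letter) (T : List (List Letter)) :
    normalVal φ Q T ≠ zeroElt ↔
      (∀ x ∈ Q, letterVal φ x = firstElt) ∧ wordVal φ (tailWord T) ≠ zeroElt := by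
  constructor
  · intro h
    have hQ := (ne_zero_of_mul _ _ (ne_zero_of_mul _ _ h).1).1
    refine ⟨?_, (ne_zero_of_mul _ _ (ne_zero_of_mul _ _ h).1).2⟩
    obtain ⟨c, hc, hv⟩ := letterVal_eq_of_sq hφ hQ
    rcases hc with rfl | rfl
    · exact hv
    · rcases wordVal_const (Or.inr rfl) hv with hn | hv
      · simp [hn]
      · refine absurd ?_ h
        rw [normalVal, sqVal, hv, IsIdem.mul_self (Or.inr rfl), last_conj]
  · rintro ⟨hQ, hT⟩
    rcases wordVal_const (Or.inl rfl) hQ with rfl | hv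
    · rwa [normalVal_nil]
    · rwa [normalVal, sqVal, hv, IsIdem.mul_self (Or.inl rfl), first_conj]

open Classical in
/-- The assignment that gives the letters in `F` the value `4` and those in `G` the value `3`, when
`F` and `G` are disjoint and jointly consistent. Other variables have the value `3`. -/
noncomputable def cut (F G : List Letter) (n : ℕ) : A0One :=
  if (n, false) ∈ F ∨ (n, true) ∈ G then firstElt else lastElt

lemma cut_ne_one (F G : List Letter) (n : ℕ) : cut F G n ≠ 1 := by
  unfold cut; split_ifs <;> decide

lemma star_firstElt : star firstElt = lastElt := by decide

lemma star_lastElt : star lastElt = firstElt := by decide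

lemma cut_left {F G : List Letter} (hc : Consistent (F ++ G)) (hd : F.Disjoint G)
    {x : Letter} (hx : x ∈ F) : letterVal (cut F G) x = firstElt := by
  rcases x with ⟨n, _ | _⟩
  · simp [letterVal, cut, hx]
  · have h1 : (n, false) ∉ F := fun h => hc _ (List.mem_append_left G h) (by simp [bar, hx])
    have h2 : (n, true) ∉ G := fun h => hd hx h
    simp [letterVal, cut, h1, h2, star_lastElt]

lemma cut_right {F G : List Letter} (hc : Consistent (F ++ G)) (hd : F.Disjoint G)
    {x : Letter} (hx : x ∈ G) : letterVal (cut F G) x = lastElt := by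
  rcases x with ⟨n, _ | _⟩
  · have h1 : (n, false) ∉ F := fun h => hd h hx
    have h2 : (n, true) ∉ G := fun h => hc _ (List.mem_append_right F h) (by simp [bar, hx])
    simp [letterVal, cut, h1, h2]
  · simp [letterVal, cut, hx, star_firstElt]

end Assignments

/-! ### Uniqueness of normal forms -/

section Uniqueness

/-- Two blocks agree if they have the same letters, and both or neither are single letters. -/
def BlockEq (B C : List Letter) : Prop := (∀ x, x ∈ B ↔ x ∈ C) ∧ (B.length = 1 ↔ C.length = 1)

lemma Consistent.eq_of_fst {w : List Letter} (hw : Consistent w) {x y : Letter} (hx : x ∈ w)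
    (hy : y ∈ w) (h : x.1 = y.1) : x = y :=
  (eq_or_eq_bar h).resolve_right fun h' => hw y hy (h' ▸ hx)

lemma Consistent.mono {u w : List Letter} (hw : Consistent w) (h : ∀ x ∈ u, x ∈ w) :
    Consistent u := fun x hx hx' => hw x (h x hx) (h _ hx')

lemma IsNormal.nil {Q : List Letter} {T : List (List Letter)} (h : IsNormal Q T) :
    IsNormal [] T :=
  ⟨h.consistent.mono fun _ hx => List.mem_append_right _ hx, by simpa using (List.pairwise_cons.1 h.disjoint).2, h.ne_nil⟩

lemma IsNormal.tail {B : List Letter} {T : List (List Letter)} (h : IsNormal [] (B :: T)) :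
    IsNormal [] T ∧ B.Disjoint T.flatten ∧ Consistent (B ++ T.flatten) ∧ B ≠ [] := by
  obtain ⟨hc, hd, hn⟩ := h
  simp only [List.pairwise_cons, List.mem_cons] at hd
  refine ⟨⟨hc.mono fun _ (hx : _ ∈ T.flatten) => List.mem_append_right B hx, by simpa using hd.2.2, fun h => hn (by simp [h])⟩, ?_,
    by simpa using hc, fun h => hn (by simp [h])⟩
  intro x hx hx'
  obtain ⟨C, hC, hxC⟩ := List.mem_flatten.1 hx'
  exact hd.2.1 C hC hx hxC

lemma IsNormal.disjoint_flatten {Q : List Letter} {T : List (List Letter)} (h : IsNormal Q T) :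
    Q.Disjoint T.flatten := by
  intro x hx hx'
  obtain ⟨C, hC, hxC⟩ := List.mem_flatten.1 hx'
  exact (List.pairwise_cons.1 h.disjoint).1 C hC hx hxC

/-- Two normal forms without `Q` are nonzero under the same assignments. -/
def SameSupport (T T' : List (List Letter)) : Prop :=
  ∀ φ : ℕ → A0One, (∀ n, φ n ≠ 1) →
    (wordVal φ (tailWord T) ≠ zeroElt ↔ wordVal φ (tailWord T') ≠ zeroElt)

lemma SameSupport.symm {T T' : List (List Letter)} (h : SameSupport T T') : SameSupport T' T :=
  fun φ hφ => (h φ hφ).symm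

/-- Cut `T'` behind its first block: the letters there are `4`, the later ones `3`. As `T` is nonzero
too, a letter with value `3` in its first block would force every letter to be `3`. -/
lemma first_block_subset {B B' : List Letter} {R R' : List (List Letter)}
    (h' : IsNormal [] (B' :: R'))
    (hmem : ∀ x, x ∈ (B :: R).flatten ↔ x ∈ (B' :: R').flatten)
    (hs : SameSupport (B :: R) (B' :: R')) : ∀ x ∈ B, x ∈ B' := by
  obtain ⟨-, hd', hc', hn'⟩ := h'.tail
  intro b hb
  by_contra hb'
  have hφ := cut_ne_one B' R'.flatten
  have hF : ∀ x ∈ B', letterVal (cut B' R'.flatten) x = firstElt := fun x hx => cut_left hc' hd' hx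
  have hL : ∀ x ∈ R'.flatten, letterVal (cut B' R'.flatten) x = lastElt :=
    fun x hx => cut_right hc' hd' hx
  have h1 := (hs _ hφ).2 ((first_block_mul hF).2
    (wordVal_const_ne (Or.inr rfl) fun x hx => hL x (mem_tailWord.1 hx)))
  have hbR : b ∈ R'.flatten := by
    have : b ∈ (B' :: R').flatten := (hmem b).1 (by simp [hb])
    simpa only [List.flatten_cons, List.mem_append, hb', false_or] using this
  obtain ⟨y, hy⟩ := List.exists_mem_of_ne_nil _ hn'
  have h2 := tail_eq_last hφ h1 hb (hL b hbR) y ((hmem y).2 (by simp [hy]))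
  exact first_ne_last ((hF y hy).symm.trans h2)

open Classical in
/-- A linear letter may be given the value `1 = 4 · 3`, which is not possible for a square. -/
lemma first_block_length {B B' : List Letter} {R R' : List (List Letter)}
    (h : IsNormal [] (B :: R)) (hB : ∀ x, x ∈ B ↔ x ∈ B')
    (hs : SameSupport (B :: R) (B' :: R')) (hl : B.length = 1) : B'.length = 1 := by
  by_contra hl'
  obtain ⟨t, rfl⟩ := List.length_eq_one_iff.1 hl
  obtain ⟨-, hd, hc, -⟩ := h.tail
  set φ : ℕ → A0One := fun n => if n = t.1 then firstElt * lastElt else cut [] R.flatten n with hdef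
  have hφ : ∀ n, φ n ≠ 1 := fun n => by
    rw [hdef]; dsimp only; split_ifs
    · decide
    · exact cut_ne_one _ _ _
  have ht : letterVal φ t = firstElt * lastElt := by
    have h1 : φ t.1 = firstElt * lastElt := by simp [hdef]
    unfold letterVal
    rw [h1]
    rcases t.2 with _ | _ <;> decide
  have hR : ∀ x ∈ R.flatten, letterVal φ x = lastElt := fun x hx => by
    have hne : x.1 ≠ t.1 := fun he => by
      obtain rfl := hc.eq_of_fst (List.mem_append_right [t] hx) (by simp) he
      exact hd (by simp) hx
    rw [letterVal_congr (ψ := cut [] R.flatten) (by simp [hdef, hne])]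
    exact cut_right (hc.mono fun _ hx => List.mem_append_right _ hx) (by simp) hx
  have h1 : wordVal φ (tailWord ([t] :: R)) ≠ zeroElt := by
    have e : blockWord [t] = [t] := rfl
    rw [tailWord_cons, wordVal_append, e, wordVal_cons, wordVal_nil, mul_one, ht]
    rcases wordVal_const (Or.inr rfl) fun x hx => hR x (mem_tailWord.1 hx) with h | h
    · rw [h, wordVal_nil]; decide
    · rw [h]; decide
  have h2 := (hs φ hφ).1 h1
  rw [tailWord_cons, wordVal_append, wordVal_blockWord φ hl'] at h2
  obtain ⟨c, hc, hv⟩ := letterVal_eq_of_sq hφ (ne_zero_of_mul _ _ h2).1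
  have h3 := hv t ((hB t).1 (by simp))
  rw [ht] at h3
  rcases hc with rfl | rfl
  · exact absurd h3 (by decide)
  · exact absurd h3 (by decide)

open Classical in
/-- Normal forms without `Q` that have the same letters and are nonzero under the same assignments
have the same blocks in the same order. -/
lemma blocks_eq {T T' : List (List Letter)} (h : IsNormal [] T) (h' : IsNormal [] T')
    (hmem : ∀ x, x ∈ T.flatten ↔ x ∈ T'.flatten) (hs : SameSupport T T') :
    List.Forall₂ BlockEq T T' := by
  induction T generalizing T' with
  | nil =>
    cases T' with
    | nil => exact .nil
    | cons B' R' =>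
      obtain ⟨y, hy⟩ := List.exists_mem_of_ne_nil _ h'.tail.2.2.2
      have : y ∈ ([] : List (List Letter)).flatten := (hmem y).2 (by simp [hy])
      simp at this
  | cons B R ih =>
    cases T' with
    | nil =>
      obtain ⟨y, hy⟩ := List.exists_mem_of_ne_nil _ h.tail.2.2.2
      have : y ∈ ([] : List (List Letter)).flatten := (hmem y).1 (by simp [hy])
      simp at this
    | cons B' R' =>
      have hB : ∀ x, x ∈ B ↔ x ∈ B' := fun x => ⟨first_block_subset h' hmem hs x,
        first_block_subset h (fun x => (hmem x).symm) hs.symm x⟩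
      obtain ⟨hR, hd, hc, -⟩ := h.tail
      obtain ⟨hR', hd', -, -⟩ := h'.tail
      have hmemR : ∀ x, x ∈ R.flatten ↔ x ∈ R'.flatten := fun x => by
        have := hmem x
        simp only [List.flatten_cons, List.mem_append, ← hB] at this
        have h1 : x ∈ B → x ∉ R.flatten := fun h => hd h
        have h2 : x ∈ B → x ∉ R'.flatten := fun h => hd' ((hB x).1 h)
        tauto
      refine .cons ⟨hB, first_block_length h hB hs,
        first_block_length h' (fun x => (hB x).symm) hs.symm⟩ (ih hR hR' hmemR ?_)
      intro φ hφ
      set ψ : ℕ → A0One := fun n => if ∃ x ∈ B, x.1 = n then cut B [] n else φ n with hdef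
      have hψ : ∀ n, ψ n ≠ 1 := fun n => by
        rw [hdef]; dsimp only; split_ifs
        · exact cut_ne_one _ _ _
        · exact hφ n
      have hψB : ∀ x ∈ B, letterVal ψ x = firstElt := fun x hx => by
        have hx1 : ∃ y ∈ B, y.1 = x.1 := ⟨x, hx, rfl⟩
        rw [letterVal_congr (ψ := cut B []) (by simp only [hdef, if_pos hx1])]
        exact cut_left (hc.mono (by simp +contextual)) (by simp) hx
      have hψR : ∀ x ∈ R.flatten, letterVal ψ x = letterVal φ x := fun x hx => by
        have hx1 : ¬ ∃ y ∈ B, y.1 = x.1 := by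
          rintro ⟨y, hy, he⟩
          obtain rfl := hc.eq_of_fst (List.mem_append_left _ hy) (List.mem_append_right _ hx) he
          exact hd hy hx
        exact letterVal_congr (by simp only [hdef, if_neg hx1])
      have := hs ψ hψ
      rwa [first_block_mul hψB, first_block_mul fun x hx => hψB x ((hB x).2 hx), tail_congr hψR,
        tail_congr fun x hx => hψR x ((hmemR x).2 hx)] at this

/-- If the first block of `T'` meets `T`, then both have the same letters, so the same blocks. -/
lemma blocks_eq_of_mem {T R' : List (List Letter)} {B' : List Letter} (h : IsNormal [] T)
    (h' : IsNormal [] (B' :: R'))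
    (hv : ∀ x ∈ T.flatten, ∃ y ∈ (B' :: R').flatten, y.1 = x.1)
    (hv' : ∀ x ∈ (B' :: R').flatten, ∃ y ∈ T.flatten, y.1 = x.1)
    (hs : SameSupport T (B' :: R')) {y : Letter} (hy : y ∈ B') (hyT : y ∈ T.flatten) :
    List.Forall₂ BlockEq T (B' :: R') := by
  have hc : Consistent ([] ++ T.flatten) := h.consistent
  have hL : ∀ x ∈ T.flatten, letterVal (cut [] T.flatten) x = lastElt :=
    fun x hx => cut_right hc (by simp) hx
  have hφ := cut_ne_one [] T.flatten
  have h1 := (hs _ hφ).1 (wordVal_const_ne (Or.inr rfl) fun x hx => hL x (mem_tailWord.1 hx))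
  have h2 := tail_eq_last hφ h1 hy (hL y hyT)
  have hsub : ∀ x ∈ (B' :: R').flatten, x ∈ T.flatten := fun x hx => by
    obtain ⟨z, hz, he⟩ := hv' x hx
    rcases eq_or_eq_bar he.symm with rfl | rfl
    · exact hz
    · have := h2 _ hx
      rw [letterVal_bar, hL z hz, star_lastElt] at this
      exact absurd this first_ne_last
  refine blocks_eq h h' (fun x => ⟨fun hx => ?_, hsub x⟩) hs
  obtain ⟨z, hz, he⟩ := hv x hx
  rwa [← hc.eq_of_fst (by simpa using hsub z hz) (by simpa using hx) he]

/-- Two normal forms are nonzero under the same assignments. -/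
def SameSupportForm (Q Q' : List Letter) (T T' : List (List Letter)) : Prop :=
  ∀ φ : ℕ → A0One, (∀ n, φ n ≠ 1) → (normalVal φ Q T ≠ zeroElt ↔ normalVal φ Q' T' ≠ zeroElt)

lemma IsNormal.cut_last {Q : List Letter} {T : List (List Letter)} (h : IsNormal Q T) :
    normalVal (cut Q T.flatten) Q T ≠ zeroElt := by
  rw [normalVal_ne_zeroElt (cut_ne_one _ _)]
  refine ⟨fun x hx => cut_left h.consistent h.disjoint_flatten hx, ?_⟩
  exact wordVal_const_ne (Or.inr rfl)
    fun x hx => cut_right h.consistent h.disjoint_flatten (mem_tailWord.1 hx)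

lemma IsNormal.cut_first {Q : List Letter} {T : List (List Letter)} (h : IsNormal Q T) :
    normalVal (cut (Q ++ T.flatten) []) Q T ≠ zeroElt := by
  have hv : ∀ x ∈ Q ++ T.flatten, letterVal (cut (Q ++ T.flatten) []) x = firstElt :=
    fun x hx => cut_left (by simpa using h.consistent) (by simp) hx
  rw [normalVal_ne_zeroElt (cut_ne_one _ _)]
  exact ⟨fun x hx => hv x (by simp [hx]), wordVal_const_ne (Or.inl rfl)
    fun x hx => hv x (List.mem_append_right _ (mem_tailWord.1 hx))⟩

open Classical in
/-- A variable that occurs in one form only could be given the value `2`. -/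
lemma vars_subset {Q Q' : List Letter} {T T' : List (List Letter)} (h' : IsNormal Q' T')
    (hs : SameSupportForm Q Q' T T') :
    ∀ x ∈ Q ++ T.flatten, ∃ y ∈ Q' ++ T'.flatten, y.1 = x.1 := by
  intro x hx
  by_contra hcon
  push Not at hcon
  set φ : ℕ → A0One := fun n => if n = x.1 then zeroElt else cut Q' T'.flatten n with hdef
  have hφ : ∀ n, φ n ≠ 1 := fun n => by
    rw [hdef]; dsimp only; split_ifs
    · decide
    · exact cut_ne_one _ _ _
  have hx0 : letterVal φ x = zeroElt := by
    have h1 : φ x.1 = zeroElt := by simp [hdef]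
    unfold letterVal
    rw [h1]
    rcases x.2 with _ | _ <;> decide
  have heq : ∀ y ∈ Q' ++ T'.flatten, letterVal φ y = letterVal (cut Q' T'.flatten) y :=
    fun y hy => letterVal_congr (by simp [hdef, hcon y hy])
  have h1 : normalVal φ Q' T' ≠ zeroElt := by
    have h2 := h'.cut_last
    rw [normalVal_ne_zeroElt (cut_ne_one _ _)] at h2
    rw [normalVal_ne_zeroElt hφ, tail_congr fun y hy => heq y (List.mem_append_right _ hy)]
    exact ⟨fun y hy => by rw [heq y (List.mem_append_left _ hy), h2.1 y hy], h2.2⟩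
  have h2 := (normalVal_ne_zeroElt hφ Q T).1 ((hs φ hφ).2 h1)
  rcases List.mem_append.1 hx with hx | hx
  · exact absurd (hx0.symm.trans (h2.1 x hx)) (by decide)
  · exact letterVal_ne_zeroElt h2.2 (mem_tailWord.2 hx) hx0

/-- The letters in `Q` are those which must have the value `4` for the form to be nonzero. -/
lemma left_subset {Q Q' : List Letter} {T T' : List (List Letter)} (h' : IsNormal Q' T')
    (hs : SameSupportForm Q Q' T T') : ∀ x ∈ Q, x ∈ Q' := by
  intro x hx
  have h1 := ((normalVal_ne_zeroElt (cut_ne_one _ _) Q T).1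
    ((hs _ (cut_ne_one _ _)).2 h'.cut_last)).1 x hx
  have h2 := ((normalVal_ne_zeroElt (cut_ne_one _ _) Q T).1
    ((hs _ (cut_ne_one _ _)).2 h'.cut_first)).1 x hx
  obtain ⟨y, hy, he⟩ := vars_subset h' hs x (List.mem_append_left _ hx)
  have hy2 := cut_left (G := []) (by simpa using h'.consistent) (by simp) hy
  have hxy : x = y := by
    rcases eq_or_eq_bar he.symm with rfl | rfl
    · rfl
    · rw [letterVal_bar, hy2, star_firstElt] at h2
      exact absurd h2.symm first_ne_last
  subst hxy
  refine (List.mem_append.1 hy).resolve_right fun hy => ?_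
  rw [cut_right h'.consistent h'.disjoint_flatten hy] at h1
  exact first_ne_last h1.symm

open Classical in
/-- Setting the letters of `Q` to `4` leaves the assignment free on the variables of `T` and `T'`. -/
lemma sameSupport_of_form {Q Q' : List Letter} {T T' : List (List Letter)} (h : IsNormal Q T)
    (h' : IsNormal Q' T') (hQ : ∀ x, x ∈ Q ↔ x ∈ Q') (hs : SameSupportForm Q Q' T T') :
    SameSupport T T' := by
  intro φ hφ
  set ψ : ℕ → A0One := fun n => if ∃ x ∈ Q, x.1 = n then cut Q [] n else φ n with hdef
  have hψ : ∀ n, ψ n ≠ 1 := fun n => by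
    rw [hdef]; dsimp only; split_ifs
    · exact cut_ne_one _ _ _
    · exact hφ n
  have hψQ : ∀ x ∈ Q, letterVal ψ x = firstElt := fun x hx => by
    have hx1 : ∃ y ∈ Q, y.1 = x.1 := ⟨x, hx, rfl⟩
    rw [letterVal_congr (ψ := cut Q []) (by simp only [hdef, if_pos hx1])]
    exact cut_left (h.consistent.mono (by simp +contextual)) (by simp) hx
  have key : ∀ P S, IsNormal P S → (∀ x ∈ Q, x ∈ P) →
      ∀ x ∈ S.flatten, letterVal ψ x = letterVal φ x := fun P S hN hsub x hx => by
    have hx1 : ¬ ∃ y ∈ Q, y.1 = x.1 := by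
      rintro ⟨y, hy, he⟩
      obtain rfl := hN.consistent.eq_of_fst (List.mem_append_left _ (hsub y hy))
        (List.mem_append_right _ hx) he
      exact hN.disjoint_flatten (hsub y hy) hx
    exact letterVal_congr (by simp only [hdef, if_neg hx1])
  have := hs ψ hψ
  rw [normalVal_ne_zeroElt hψ, normalVal_ne_zeroElt hψ, tail_congr (key Q T h fun _ h => h),
    tail_congr (key Q' T' h' fun x => (hQ x).1)] at this
  rwa [and_iff_right hψQ, and_iff_right fun x hx => hψQ x ((hQ x).2 hx)] at this

/-- A normal form is determined by the assignments under which it is nonzero, up to the choice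
between `T` and its involute. -/
theorem form_unique {Q Q' : List Letter} {T T' : List (List Letter)} (h : IsNormal Q T)
    (h' : IsNormal Q' T') (hs : SameSupportForm Q Q' T T') :
    (∀ x, x ∈ Q ↔ x ∈ Q') ∧
      (List.Forall₂ BlockEq T T' ∨ List.Forall₂ BlockEq (barTail T) T') := by
  have hs' : SameSupportForm Q' Q T' T := fun φ hφ => (hs φ hφ).symm
  have hQ : ∀ x, x ∈ Q ↔ x ∈ Q' := fun x => ⟨left_subset h' hs x, left_subset h hs' x⟩
  refine ⟨hQ, ?_⟩
  have hT := sameSupport_of_form h h' hQ hs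
  have sub : ∀ S S', IsNormal [] S' → SameSupport S S' →
      ∀ x ∈ S.flatten, ∃ y ∈ S'.flatten, y.1 = x.1 := fun S S' hS' hSS x hx => by
    have : SameSupportForm [] [] S S' := fun φ hφ => by
      simpa only [normalVal_nil] using hSS φ hφ
    simpa only [List.nil_append] using vars_subset hS' this x (by simpa only [List.nil_append])
  cases T' with
  | nil =>
    cases T with
    | nil => exact Or.inl .nil
    | cons B R =>
      obtain ⟨y, hy⟩ := List.exists_mem_of_ne_nil _ h.nil.tail.2.2.2
      obtain ⟨z, hz, -⟩ := sub _ _ h'.nil hT y (by simp [hy])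
      simp at hz
  | cons B' R' =>
    have main : ∀ S, IsNormal [] S → SameSupport S (B' :: R') → ∀ y ∈ B', y ∈ S.flatten →
        List.Forall₂ BlockEq S (B' :: R') := fun S hS hSS y hy hyS =>
      blocks_eq_of_mem hS h'.nil (sub _ _ h'.nil hSS) (sub _ _ hS hSS.symm) hSS hy hyS
    obtain ⟨y, hy⟩ := List.exists_mem_of_ne_nil _ h'.nil.tail.2.2.2
    obtain ⟨x, hx, he⟩ := sub _ _ h.nil hT.symm y (by simp [hy])
    rcases eq_or_eq_bar he with rfl | rfl
    · exact Or.inl (main T h.nil hT x hy hx)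
    · refine Or.inr (main _ h.nil.barTail (fun φ hφ => ?_) y hy (mem_flatten_barTail.2 hx))
      rw [wordVal_barTail, star_ne_zeroElt]
      exact hT φ hφ

lemma tail_eq_of_blockEq {M : Type*} [Monoid M] [StarMul M] (hM : Laws M) {φ : ℕ → M}
    (hφ : ∀ n, φ n ≠ 1) {T T' : List (List Letter)} (h : List.Forall₂ BlockEq T T') :
    wordVal φ (tailWord T) = wordVal φ (tailWord T') := by
  induction h with
  | nil => rfl
  | @cons B B' R R' hB _ ih =>
    rw [tailWord_cons, tailWord_cons, wordVal_append, wordVal_append, ih]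
    congr 1
    by_cases hl : B.length = 1
    · have hl' := hB.2.1 hl
      obtain ⟨x, rfl⟩ := List.length_eq_one_iff.1 hl
      obtain ⟨y, rfl⟩ := List.length_eq_one_iff.1 hl'
      obtain rfl : x = y := by simpa using (hB.1 x).1
      rfl
    · rw [wordVal_blockWord φ hl, wordVal_blockWord φ (mt hB.2.2 hl), sqVal_congr hM hφ hB.1]

/-- Words with equal values in `A₀` have equal values in every model. -/
theorem wordVal_eq_of_a0 {w w' : List Letter}
    (heq : ∀ φ : ℕ → A0One, (∀ n, φ n ≠ 1) → wordVal φ w = wordVal φ w')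
    {M : Type} [Monoid M] [StarMul M] (hM : Laws M) {φ : ℕ → M} (hφ : ∀ n, φ n ≠ 1) :
    wordVal φ w = wordVal φ w' := by
  have zero_form : ∀ {u v Q T}, IsZeroWord u → IsNormal Q T → HasForm v Q T →
      ¬ ∀ φ : ℕ → A0One, (∀ n, φ n ≠ 1) → wordVal φ u = wordVal φ v := by
    intro u v Q T hz hN hF he
    have hc := cut_ne_one Q T.flatten
    have h1 := hN.cut_last
    rw [← hF _ laws_a0One _ hc, ← he _ hc, ← (hz _ laws_a0One _ hc zeroElt).1, mul_zeroElt] at h1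
    exact h1 rfl
  rcases exists_form w with hz | ⟨Q, T, hN, hF⟩ <;>
    rcases exists_form w' with hz' | ⟨Q', T', hN', hF'⟩
  · exact ((hz M hM φ hφ (wordVal φ w')).1).symm.trans (hz' M hM φ hφ (wordVal φ w)).2
  · exact absurd heq (zero_form hz hN' hF')
  · exact absurd (fun φ hφ => (heq φ hφ).symm) (zero_form hz' hN hF)
  have hval : ∀ φ : ℕ → A0One, (∀ n, φ n ≠ 1) → normalVal φ Q T = normalVal φ Q' T' :=
    fun φ hφ => by rw [← hF _ laws_a0One φ hφ, ← hF' _ laws_a0One φ hφ, heq φ hφ]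
  obtain ⟨hQ, hT⟩ := form_unique hN hN' fun φ hφ => by rw [hval φ hφ]
  rw [hF M hM φ hφ, hF' M hM φ hφ, ← normalVal_congr hM hφ hQ]
  rcases hT with hT | hT
  · rw [normalVal, normalVal, tail_eq_of_blockEq hM hφ hT]
  by_cases hQn : Q = []
  · subst hQn
    obtain rfl : Q' = [] := List.eq_nil_iff_forall_not_mem.2 fun x hx => by simpa using (hQ x).2 hx
    cases T with
    | nil => cases hT; rfl
    | cons B R =>
      -- If all letters of `T` have the value `3`, then `T` has the value `3` and its involute `4`.
      exfalso
      have hc := cut_ne_one [] (B :: R).flatten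
      have hv := hval _ hc
      have hL : ∀ x ∈ (B :: R).flatten, letterVal (cut [] (B :: R).flatten) x = lastElt :=
        fun x hx => cut_right hN.consistent hN.disjoint_flatten hx
      have h1 := (wordVal_const (Or.inr rfl) fun x hx => hL x (mem_tailWord.1 hx)).resolve_left (by
        obtain ⟨y, hy⟩ := List.exists_mem_of_ne_nil _ hN.tail.2.2.2
        exact List.ne_nil_of_mem (mem_tailWord.2 (by simp [hy] : y ∈ (B :: R).flatten)))
      rw [normalVal_nil, normalVal_nil, ← tail_eq_of_blockEq laws_a0One hc hT, wordVal_barTail, h1,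
        star_lastElt] at hv
      exact first_ne_last hv.symm
  · rw [← normalVal_barTail hM hφ hQn, normalVal, normalVal, tail_eq_of_blockEq hM hφ hT]

end Uniqueness

/-! ### From equal values to deducibility -/

section Deduction

/-- The word obtained from a term by moving all stars to the variables. -/
def toWord : InvTerm → List Letter
  | .var n => [(n, false)]
  | .mul s t => toWord s ++ toWord t
  | .inv s => barWord (toWord s)

lemma wordVal_toWord {S : Type*} [Semigroup S] [StarMul S] (φ : ℕ → S) (t : InvTerm) :
    wordVal (fun n => (φ n : WithOne S)) (toWord t) = (t.eval φ : S) := by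
  induction t with
  | var n => simp [toWord, letterVal, InvTerm.eval]
  | mul s t hs ht => rw [toWord, wordVal_append, hs, ht]; rfl
  | inv s hs => rw [toWord, wordVal_barWord, hs]; rfl

/-- Semigroups with involution satisfying the basis satisfy all identities of `A₀`. -/
theorem satisfiedBy_of_a0 {e : InvIdentity} (he : e.SatisfiedBy A0) {S : Type} [Semigroup S]
    [StarMul S] (hS : ∀ d ∈ a0Basis, d.SatisfiedBy S) : e.SatisfiedBy S := by
  intro φ
  rw [← WithOne.coe_inj, ← wordVal_toWord, ← wordVal_toWord]
  refine wordVal_eq_of_a0 (fun ψ hψ => ?_) (laws_withOne hS) fun n => WithOne.coe_ne_one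
  choose χ hχ using fun n => WithOne.ne_one_iff_exists.1 (hψ n)
  obtain rfl : (fun n => (χ n : A0One)) = ψ := funext hχ
  rw [wordVal_toWord, wordVal_toWord, he]

/-- Deducibility from the basis, as an equivalence relation on terms. -/
def deducible : Setoid InvTerm :=
  Relation.EqvGen.setoid fun s t => ∃ d ∈ insert InvIdentity.assoc a0Basis,
    InvIdentity.DirectlyDeduces d s t

lemma deducible_map {f : InvTerm → InvTerm}
    (hf : ∀ p q s t, InvTerm.Replace p q s t → InvTerm.Replace p q (f s) (f t)) {s t : InvTerm}
    (h : deducible s t) : deducible (f s) (f t) := by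
  induction h with
  | rel s t h =>
    obtain ⟨d, hd, φ, hφ⟩ := h
    exact .rel _ _ ⟨d, hd, φ, hf _ _ _ _ hφ⟩
  | refl s => exact .refl _
  | symm s t _ ih => exact ih.symm
  | trans s t u _ _ ih1 ih2 => exact ih1.trans _ _ _ ih2

lemma deducible_subst {d : InvIdentity} (hd : d ∈ insert InvIdentity.assoc a0Basis)
    (φ : ℕ → InvTerm) : deducible (d.lhs.subst φ) (d.rhs.subst φ) :=
  .rel _ _ ⟨d, hd, φ, .here⟩

/-- The free involution semigroup of the variety defined by the basis: terms modulo deducibility. -/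
abbrev FreeModel : Type := Quotient deducible

instance : Mul FreeModel := ⟨Quotient.map₂ (· * ·) fun _ s' hs t _ ht =>
  (deducible_map (f := (· * t)) (fun _ _ _ _ h => h.mul_left t) hs).trans _ _ _
    (deducible_map (f := (s' * ·)) (fun _ _ _ _ h => h.mul_right s') ht)⟩

instance : Star FreeModel := ⟨Quotient.map star fun _ _ h =>
  deducible_map (fun _ _ _ _ h => h.inv) h⟩

lemma eval_mk (φ : ℕ → InvTerm) (t : InvTerm) :
    t.eval (fun n => (⟦φ n⟧ : FreeModel)) = ⟦t.subst φ⟧ := by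
  induction t with
  | var n => rfl
  | mul s t hs ht => rw [InvTerm.eval, hs, ht]; rfl
  | inv s hs => rw [InvTerm.eval, hs]; rfl

lemma eval_eq {d : InvIdentity} (hd : d ∈ insert InvIdentity.assoc a0Basis) (φ : ℕ → FreeModel) :
    d.lhs.eval φ = d.rhs.eval φ := by
  have h : (fun n => (⟦(φ n).out⟧ : FreeModel)) = φ := funext fun n => Quotient.out_eq _
  rw [← h, eval_mk, eval_mk]
  exact Quotient.sound (deducible_subst hd _)

instance : Semigroup FreeModel where
  mul_assoc a b c := eval_eq (d := InvIdentity.assoc) (Or.inl rfl)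
    fun n => if n = 0 then a else if n = 1 then b else c

instance : StarMul FreeModel where
  star_involutive a := eval_eq (d := star (star A0Basis.x) ≈ᵢ A0Basis.x)
    (Or.inr (by simp [a0Basis, A0Basis.involution])) fun _ => a
  star_mul a b := eval_eq
    (d := star (A0Basis.x * A0Basis.y) ≈ᵢ star A0Basis.y * star A0Basis.x)
    (Or.inr (by simp [a0Basis, A0Basis.involution])) fun n => if n = 0 then a else b

lemma subst_var (t : InvTerm) : t.subst InvTerm.var = t := by
  induction t with
  | var n => rfl
  | mul s t hs ht => rw [InvTerm.subst, hs, ht]; rfl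
  | inv s hs => rw [InvTerm.subst, hs]; rfl

end Deduction

end A0Words

/-! ### The identity basis -/

open A0Words in
theorem theorem4p1 : a0Basis.Finite ∧ InvIdentity.IsBasisFor a0Basis A0 := by
  refine ⟨?_, a0_satisfies, fun e he => ?_⟩
  · simp only [a0Basis, A0Basis.involution, A0Basis.zero, A0Basis.middle, A0Basis.transfer,
      A0Basis.square, A0Basis.plain]
    exact Set.toFinite _
  · have h := satisfiedBy_of_a0 he (S := FreeModel) (fun d hd => eval_eq (Or.inr hd))
      fun n => ⟦InvTerm.var n⟧
    rw [eval_mk, eval_mk, subst_var, subst_var] at h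
    exact Quotient.exact h
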